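/- **Setting.** An $N$-layer VAE on data $x\in\mathbb{R}^D$ with scalar latent variables $z=(z_1,\dots,z_N)\in\mathbb{R}^N$ consists of a generator $p(x\mid z)=\prod_k p(x_k\mid z)$, a prior $p_\theta(z)=\prod_{i=1}^N p_\theta(z_i\mid z_{<i})$ and an approximate posterior $q_\phi(z\mid x)=\prod_{i=1}^N q_\phi(z_i\mid z_{<i},x)$, both given in reparameterized form: let $g_1,\dots,g_N$ be arbitrary fixed probability densities on $\mathbb{R}$ and let $\varepsilon=(\varepsilon_1,\dots,\varepsilon_N)$ have the base density $p_N(\varepsilon)=\prod_i g_i(\varepsilon_i)$; each conditional distribution is the law of $z_i=\tau_i(c,\varepsilon_i)$, where $c=z_{<i}$ for the prior, $c=(x,z_{<i})$ for the posterior, and $\tau_i$ is jointly $C^1$ with $\partial\tau_i/\partial\varepsilon_i>0$. Solving $z_i=\tau_i(c,\varepsilon_i)$ recursively gives $z=f(\varepsilon)$ (with $f$ depending on $x$ for the posterior). Let $\sigma$ be a $C^1$ sigmoid ($\sigma'>0$, $\sigma(-\infty)=0$, $\sigma(+\infty)=1$). An $N$-layer VAE is called *neural* (with activation $\sigma$)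 if every layer of the prior and of the posterior has the form $$\tau(c,\varepsilon)=\mu(c)+e^{s(c)}\varepsilon+\sum_{k=1}^{K}e^{w_k(c)}\,\sigma\big(e^{a_k(c)}\varepsilon+b_k(c)\big),$$ with $K\ge 0$ finite and $\mu,s,w,a,b$ computed by fully connected feedforward networks with activation $\sigma$ (any finite depth and widths). For $K=0$ and Gaussian noise this is the usual Gaussian layer. **Proposition 2.** $N$-layer VAEs are universal approximators of $N$-dimensional latent densities: 1. *(Autoregressive flow.)* For every $N$-layer VAE, the prior, and the posterior for every $x$, is the law of $f(\varepsilon)$, where $f:\mathbb{R}^N\to\mathbb{R}^N$ is an injective $C^1$ map (surjective if every $\tau_i(c,\cdot)$ is surjective), $f_i$ depends only on $\varepsilon_1,\dots,\varepsilon_i$, and its Jacobian is everywhere lower triangular with positive diagonal. The conditional distributions of the layers have (jointly measurable) densities whose product $p$ is a density of this law, and these can be chosen such that for all $\varepsilon$ $$p(f(\varepsilon))\,\Big|\det\frac{\partial f}{\partial\varepsilon}(\varepsilon)\Big|=p_N(\varepsilon).$$ 2. *(Universality.)* Let $\sigma$ be as above, let any generator $p(x\mid z)=\prod_k p(x_k\mid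 z)$, any probability density $p$ on $\mathbb{R}^N$, any jointly measurable family $q(\cdot\mid x)$, $x\in\mathbb{R}^D$, of probability densities on $\mathbb{R}^N$, and any probability measure $\mu$ on $\mathbb{R}^D$ be given. Then there is a sequence of neural $N$-layer VAEs (of finite but growing capacity) with this generator such that their priors converge in distribution to $p$, and their posteriors given $x$ converge in distribution to $q(\cdot\mid x)$ for $\mu$-almost every $x$. If $x\mapsto q(\cdot\mid x)$ is continuous with respect to convergence in distribution, the posteriors can be taken to converge for every $x\in\mathbb{R}^D$. -/

import Mathlib

open MeasureTheory ProbabilityTheory Filter Topology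

noncomputable section

/-- A probability density with respect to Lebesgue measure (`volume`). -/
structure Density (E : Type) [MeasureSpace E] where
  pdf : E → ℝ
  measurable_pdf : Measurable pdf
  nonneg : ∀ z, 0 ≤ pdf z
  lintegral_eq_one : ∫⁻ z, ENNReal.ofReal (pdf z) = 1

namespace Density

variable {E : Type} [MeasureSpace E]

/-- The measure `p(z) dz`. -/
def measure (p : Density E) : Measure E :=
  volume.withDensity (fun z => ENNReal.ofReal (p.pdf z))

instance (p : Density E) : IsProbabilityMeasure p.measure :=
  ⟨by simpa [measure] using p.lintegral_eq_one⟩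

/-- The probability distribution `p(z) dz`; Mathlib's topology on `ProbabilityMeasure` is that of
convergence in distribution. -/
def law (p : Density E) : ProbabilityMeasure E := ⟨p.measure, inferInstance⟩

end Density

/-- The reparameterized layers of a top-down distribution over `N` scalar latent variables,
given `d` conditioning inputs.  Layer `i` samples `z_i` given the inputs `x` and the previous latent
variables `z_{<i}` as `z_i = layer i (x, z_{<i}) ε_i` with scalar noise `ε_i`. -/
structure TopDown (d N : ℕ) where
  layer : (i : Fin N) → (Fin (d + i) → ℝ) → ℝ → ℝ
  contDiff : ∀ i : Fin N, ContDiff ℝ 1 (fun p : (Fin (d + i) → ℝ) × ℝ => layer i p.1 p.2)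
  deriv_pos : ∀ (i : Fin N) c e, 0 < deriv (layer i c) e

namespace TopDown

variable {d N : ℕ}

theorem measurable_layer (T : TopDown d N) (x : Fin d → ℝ) (i : Fin N) :
    Measurable (fun p : (Fin i → ℝ) × ℝ => T.layer i (Fin.append x p.1) p.2) := by
  have h : Measurable (fun p : (Fin i → ℝ) × ℝ => (Fin.append x p.1, p.2)) := by
    refine Measurable.prodMk (measurable_pi_lambda _ fun j => ?_) measurable_snd
    refine Fin.addCases (fun a => ?_) (fun b => ?_) j
    · simp
    · simpa [Function.comp_def] using (measurable_pi_apply b).comp measurable_fst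
  exact (T.contDiff i).continuous.measurable.comp h

/-- The conditional distribution `p(z_i | z_{<i}, x)` of layer `i`: the distribution of
`layer i (x, z_{<i}) ε_i`, where `ε_i` has density `g i`. -/
def condLaw (T : TopDown d N) (g : Fin N → Density ℝ) (x : Fin d → ℝ) (i : Fin N) :
    Kernel (Fin i → ℝ) ℝ where
  toFun c := (g i).measure.map (T.layer i (Fin.append x c))
  measurable' := by
    have hm := T.measurable_layer x i
    refine Measure.measurable_of_measurable_coe _ fun s hs => ?_
    have h1 : ∀ c : Fin i → ℝ, ((g i).measure.map (T.layer i (Fin.append x c))) s =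
        (g i).measure (Prod.mk c ⁻¹'
          ((fun p : (Fin i → ℝ) × ℝ => T.layer i (Fin.append x p.1) p.2) ⁻¹' s)) := fun c => by
      exact Measure.map_apply (hm.comp (measurable_prodMk_left (x := c))) hs
    simp only [h1]
    exact measurable_measure_prodMk_left (hm hs)

instance instIsMarkovKernelCondLaw (T : TopDown d N) (g : Fin N → Density ℝ) (x : Fin d → ℝ) (i : Fin N) :
    IsMarkovKernel (T.condLaw g x i) :=
  ⟨fun _ => Measure.isProbabilityMeasure_map
    ((T.measurable_layer x i).comp measurable_prodMk_left).aemeasurable⟩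

/-- The joint distribution of the first `n` latent variables,
`p(z_0 | x) p(z_1 | z_0, x) ⋯ p(z_{n-1} | z_{<n-1}, x)`. -/
def lawUpTo (T : TopDown d N) (g : Fin N → Density ℝ) (x : Fin d → ℝ) :
    (n : ℕ) → n ≤ N → Measure (Fin n → ℝ)
  | 0, _ => Measure.dirac default
  | n + 1, h => (T.lawUpTo g x n (Nat.le_of_succ_le h) ⊗ₘ T.condLaw g x ⟨n, h⟩).map
      (fun p => Fin.snoc (α := fun _ => ℝ) p.1 p.2)

theorem isProbabilityMeasure_lawUpTo (T : TopDown d N) (g : Fin N → Density ℝ) (x : Fin d → ℝ)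
    (n : ℕ) (h : n ≤ N) : IsProbabilityMeasure (T.lawUpTo g x n h) := by
  induction n with
  | zero => exact inferInstanceAs (IsProbabilityMeasure (Measure.dirac _))
  | succ n ih =>
    have := ih (Nat.le_of_succ_le h)
    have : IsMarkovKernel (α := Fin n → ℝ) (T.condLaw g x ⟨n, h⟩) :=
      TopDown.instIsMarkovKernelCondLaw T g x ⟨n, h⟩
    refine Measure.isProbabilityMeasure_map (Measurable.aemeasurable ?_)
    refine measurable_pi_lambda _ fun j => ?_
    refine Fin.lastCases ?_ (fun b => ?_) j
    · simpa using measurable_snd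
    · simpa [Function.comp_def] using (measurable_pi_apply b).comp measurable_fst

/-- The top-down distribution `∏ i, p(z_i | z_{<i}, x)` over the `N` latent variables. -/
def law (T : TopDown d N) (g : Fin N → Density ℝ) (x : Fin d → ℝ) :
    ProbabilityMeasure (Fin N → ℝ) :=
  ⟨T.lawUpTo g x N le_rfl, T.isProbabilityMeasure_lawUpTo g x N le_rfl⟩

/-- The latent variables as a deterministic function of the noise `ε`. -/
def flow (T : TopDown d N) (x : Fin d → ℝ) (ε : Fin N → ℝ) (i : Fin N) : ℝ :=
  T.layer i (Fin.append x (fun j : Fin i => T.flow x ε ⟨j, j.isLt.trans i.isLt⟩)) (ε i)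
termination_by i.val
decreasing_by exact j.isLt

end TopDown

/-- The Jacobian matrix of `f` at `ε`; its `(i, j)` entry is `∂f_i / ∂ε_j`. -/
def jacobian {N : ℕ} (f : (Fin N → ℝ) → (Fin N → ℝ)) (ε : Fin N → ℝ) :
    Matrix (Fin N) (Fin N) ℝ :=
  LinearMap.toMatrix' (fderiv ℝ f ε : (Fin N → ℝ) →ₗ[ℝ] (Fin N → ℝ))

/-- An autoregressive flow: an injective `C¹` map whose `i`-th output depends on the inputs
`ε_j`, `j ≤ i`, only, with lower triangular Jacobian and positive diagonal. -/
structure IsAutoregressiveFlow {N : ℕ} (f : (Fin N → ℝ) → (Fin N → ℝ)) : Prop where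
  contDiff : ContDiff ℝ 1 f
  injective : Function.Injective f
  autoregressive : ∀ i ε ε', (∀ j ≤ i, ε j = ε' j) → f ε i = f ε' i
  lowerTriangular : ∀ ε i j, i < j → jacobian f ε i j = 0
  diag_pos : ∀ ε i, 0 < jacobian f ε i i

/-- The top-down distribution given `x` is an autoregressive flow of the noise with density
`∏ i, g i (ε i)`: it is the image of the noise distribution under `T.flow x`; each
`p(z_i | z_{<i}, x)` has a density, their product `p` is the density of the top-down
distribution, and the change of variables formula `p(f(ε)) |det ∂f/∂ε| = ∏ i, g i (ε i)` holds. -/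
structure TopDown.IsFlow {d N : ℕ} (T : TopDown d N) (g : Fin N → Density ℝ)
    (x : Fin d → ℝ) : Prop where
  isAutoregressiveFlow : IsAutoregressiveFlow (T.flow x)
  surjective : (∀ i c, Function.Surjective (T.layer i c)) → Function.Surjective (T.flow x)
  law_eq_map : (T.law g x : Measure (Fin N → ℝ)) =
    (Measure.pi fun i => (g i).measure).map (T.flow x)
  exists_density : ∃ (cond : (i : Fin N) → (Fin i → ℝ) → Density ℝ) (p : Density (Fin N → ℝ)),
    (∀ i : Fin N, Measurable fun v : (Fin i → ℝ) × ℝ => (cond i v.1).pdf v.2) ∧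
    (∀ (i : Fin N) c, T.condLaw g x i c = (cond i c).measure) ∧
    (∀ z, p.pdf z =
      ∏ i : Fin N, (cond i (fun j : Fin i => z ⟨j, j.isLt.trans i.isLt⟩)).pdf (z i)) ∧
    T.law g x = p.law ∧
    ∀ ε, p.pdf (T.flow x ε) * |(jacobian (T.flow x) ε).det| = ∏ i, (g i).pdf (ε i)

/-- A VAE with `N` scalar stochastic layers on data in `ℝ^D`: a top-down prior (no conditioning
inputs), a top-down approximate posterior (conditioned on the data point `x`), and a generator
`p(x | z) = ∏ k, p(x_k | z)` with independent coordinates. -/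
structure NLayerVAE (D N : ℕ) where
  prior : TopDown 0 N
  posterior : TopDown D N
  generator : Fin D → Kernel (Fin N → ℝ) ℝ
  isMarkovKernel_generator : ∀ k, IsMarkovKernel (generator k)

/-- The generator distribution `p(x | z)`. -/
def NLayerVAE.likelihood {D N : ℕ} (V : NLayerVAE D N) (z : Fin N → ℝ) : Measure (Fin D → ℝ) :=
  Measure.pi fun k => V.generator k z

/-- Fully connected feedforward networks with `m` inputs and `k` outputs, of any depth and
any widths: the weights and biases. -/
inductive MLP (k : ℕ) : ℕ → Type
  | output {m : ℕ} (W : Matrix (Fin k) (Fin m) ℝ) (b : Fin k → ℝ) : MLP k m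
  | hidden {m : ℕ} (w : ℕ) (W : Matrix (Fin w) (Fin m) ℝ) (b : Fin w → ℝ) (next : MLP k w) :
      MLP k m

/-- The function computed by a network with activation function `σ`. -/
def MLP.eval (σ : ℝ → ℝ) {k : ℕ} : {m : ℕ} → MLP k m → (Fin m → ℝ) → (Fin k → ℝ)
  | _, .output W b, c => W.mulVec c + b
  | _, .hidden _ W b next, c => next.eval σ (fun j => σ ((W.mulVec c + b) j))

/-- A neural stochastic layer with `m` inputs: feedforward networks that output the parameters of
a monotone one-hidden-layer network, of width `K` and with a linear skip connection, acting on
the noise.  For `K = 0` it is `z = μ(c) + exp(s(c)) ε`, the usual Gaussian layer if `ε` is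
standard normal. -/
structure NeuralLayer (m : ℕ) where
  K : ℕ
  shift : MLP 1 m
  logScale : MLP 1 m
  logHeight : MLP K m
  logSlope : MLP K m
  offset : MLP K m

/-- The output of a neural stochastic layer on input `c` and noise `e`. -/
def NeuralLayer.eval (σ : ℝ → ℝ) {m : ℕ} (L : NeuralLayer m) (c : Fin m → ℝ) (e : ℝ) : ℝ :=
  L.shift.eval σ c 0 + Real.exp (L.logScale.eval σ c 0) * e +
    ∑ k : Fin L.K, Real.exp (L.logHeight.eval σ c k) *
      σ (Real.exp (L.logSlope.eval σ c k) * e + L.offset.eval σ c k)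

/-- All layers of `T` are neural stochastic layers with activation function `σ`. -/
def TopDown.IsNeural {d N : ℕ} (σ : ℝ → ℝ) (T : TopDown d N) : Prop :=
  ∃ L : (i : Fin N) → NeuralLayer (d + i), ∀ i c e, T.layer i c e = (L i).eval σ c e

/-- A `C¹` sigmoid with positive derivative, such as the logistic function. -/
structure IsSigmoid (σ : ℝ → ℝ) : Prop where
  contDiff : ContDiff ℝ 1 σ
  deriv_pos : ∀ t, 0 < deriv σ t
  tendsto_atBot : Tendsto σ atBot (𝓝 0)
  tendsto_atTop : Tendsto σ atTop (𝓝 1)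

end

/-! Flow. `T.flow x` is triangular: its `i`-th output is a strictly increasing function of `ε i`
whose parameters are the earlier outputs. Hence the noise can be recovered layer by layer, and the
Jacobian determinant is the product of the layer derivatives. Since `z_{<i}` is a function of
`ε_{<i}`, it is independent of `ε i`, so the chain of conditional kernels is the law of the flow
(`lawUpTo_eq_map`). The noise density divided by the layer derivative, extended by zero off the
range of the layer, is the conditional density; the product of these satisfies the change of
variables formula and is a density of the law (`law_eq_withDensity`).

Universality. A partition of unity centred at finitely many points `y k` shows that `q(· | x)` is
weakly close to `∑ k, W x k • δ (y k)`, where `W x k` is the integral of the `k`-th function against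
`q(· | x)`. The points are close to a dense sequence and perturbed to have distinct first
coordinates, so that `z_0` alone identifies `k`. A neural model can then nearly sample this discrete
law (`TopDown.exists_isNeural_near_points`): the first layer is a steep staircase in its noise that
jumps at approximate quantiles of the cumulative weights, so it hits the level of `y k` with
probability about `W x k`; every later layer nearly ignores its noise and outputs a continuous
function of `z_0` that interpolates the `y k`.

The thresholds and interpolants are computed by networks, uniformly on compact sets
(`MLP.exists_approx`): exponential ridge functions span an algebra, dense by Stone–Weierstrass, and
sums of sigmoids imitate the exponential. The thresholds must therefore be continuous in `x` on
compact sets; for merely measurable `q`, Lusin's theorem and Borel–Cantelli provide compact sets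
that eventually contain almost every `x` (`exists_compact_exhaustion`). -/

noncomputable section

/-! ### Products of one-dimensional densities. -/

namespace Density

variable {E : Type} [MeasureSpace E]

theorem integrable_pdf (p : Density E) : Integrable p.pdf := by
  refine ⟨p.measurable_pdf.aestronglyMeasurable, ?_⟩
  rw [hasFiniteIntegral_iff_ofReal (Eventually.of_forall p.nonneg), p.lintegral_eq_one]
  exact ENNReal.one_lt_top

theorem measure_apply_eq_integral_indicator (p : Density E) {s : Set E} (hs : MeasurableSet s) :
    p.measure s = ENNReal.ofReal (∫ z, s.indicator p.pdf z) := by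
  rw [Density.measure, withDensity_apply _ hs, integral_indicator hs,
    ofReal_integral_eq_lintegral_ofReal p.integrable_pdf.integrableOn
      (Eventually.of_forall p.nonneg)]

/-- A product of probability densities on `ℝ` is a density of the product measure. -/
theorem pi_measure_eq_withDensity {N : ℕ} (g : Fin N → Density ℝ) :
    (Measure.pi fun i => (g i).measure) =
      volume.withDensity (fun ε : Fin N → ℝ => ENNReal.ofReal (∏ i, (g i).pdf (ε i))) := by
  refine Measure.pi_eq fun s hs => ?_
  have hint : ∀ i, Integrable ((s i).indicator (g i).pdf) := fun i =>
    (g i).integrable_pdf.indicator (hs i)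
  have hnn : ∀ i z, 0 ≤ (s i).indicator (g i).pdf z := fun i =>
    Set.indicator_nonneg fun z _ => (g i).nonneg z
  rw [withDensity_apply _ (MeasurableSet.univ_pi hs),
    ← lintegral_indicator (MeasurableSet.univ_pi hs)]
  -- The indicator of a box is the product of the indicators of its sides, so the integral over the
  -- box factors.
  have hfun : ((Set.univ.pi s).indicator fun ε : Fin N → ℝ =>
      ENNReal.ofReal (∏ i, (g i).pdf (ε i))) =
      fun ε => ENNReal.ofReal (∏ i, (s i).indicator (g i).pdf (ε i)) := by
    funext ε
    by_cases h : ε ∈ Set.univ.pi s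
    · rw [Set.indicator_of_mem h]
      congr 1
      exact Finset.prod_congr rfl fun i _ => (Set.indicator_of_mem (h i (Set.mem_univ i)) _).symm
    · rw [Set.indicator_of_notMem h]
      obtain ⟨i, hi⟩ : ∃ i, ε i ∉ s i := by simpa [Set.mem_pi] using h
      rw [Finset.prod_eq_zero (Finset.mem_univ i) (Set.indicator_of_notMem hi _)]
      simp
  have hprod : Integrable fun ε : Fin N → ℝ => ∏ i, (s i).indicator (g i).pdf (ε i) :=
    Integrable.fintype_prod hint
  rw [hfun, ← ofReal_integral_eq_lintegral_ofReal hprod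
    (Eventually.of_forall fun ε => Finset.prod_nonneg fun i _ => hnn i _),
    integral_fintype_prod_volume_eq_prod (fun i => (s i).indicator (g i).pdf),
    ENNReal.ofReal_prod_of_nonneg fun i _ => integral_nonneg (hnn i)]
  exact Finset.prod_congr rfl fun i _ =>
    ((g i).measure_apply_eq_integral_indicator (hs i)).symm

end Density

/-! ### The autoregressive flow, its Jacobian and its density. -/

namespace TopDown

variable {d N : ℕ} (T : TopDown d N)

theorem strictMono_layer (i : Fin N) (c : Fin (d + i) → ℝ) : StrictMono (T.layer i c) :=
  strictMono_of_deriv_pos (T.deriv_pos i c)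

theorem contDiff_layer_right (i : Fin N) (c : Fin (d + i) → ℝ) : ContDiff ℝ 1 (T.layer i c) :=
  (T.contDiff i).comp (contDiff_const.prodMk contDiff_id)

theorem hasDerivAt_layer (i : Fin N) (c : Fin (d + i) → ℝ) (e : ℝ) :
    HasDerivAt (T.layer i c) (deriv (T.layer i c) e) e :=
  ((T.contDiff_layer_right i c).differentiable one_ne_zero e).hasDerivAt

/-- The inputs of layer `i`: the conditioning inputs and the previous latent variables. -/
def context (x : Fin d → ℝ) (z : Fin N → ℝ) (i : Fin N) : Fin (d + i) → ℝ :=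
  Fin.append x (fun j : Fin i => z ⟨j, j.isLt.trans i.isLt⟩)

theorem flow_apply (x : Fin d → ℝ) (ε : Fin N → ℝ) (i : Fin N) :
    T.flow x ε i = T.layer i (context x (T.flow x ε) i) (ε i) := by
  rw [flow]; rfl

theorem context_congr {x : Fin d → ℝ} {z z' : Fin N → ℝ} {i : Fin N}
    (h : ∀ j < i, z j = z' j) : context x z i = context x z' i := by
  unfold context
  congr 1
  funext j
  exact h _ j.isLt

theorem flow_congr (x : Fin d → ℝ) {ε ε' : Fin N → ℝ} (i : Fin N) (h : ∀ j ≤ i, ε j = ε' j) :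
    T.flow x ε i = T.flow x ε' i := by
  induction i using WellFoundedLT.induction with
  | ind i ih =>
    rw [flow_apply, flow_apply, h i le_rfl,
      context_congr fun j hj => ih j hj fun k hk => h k (hk.trans hj.le)]

theorem eq_flow_of_forall {x : Fin d → ℝ} {z ε : Fin N → ℝ}
    (h : ∀ i, z i = T.layer i (context x z i) (ε i)) : T.flow x ε = z := by
  funext i
  induction i using WellFoundedLT.induction with
  | ind i ih => rw [flow_apply, h, context_congr fun j hj => ih j hj]

theorem mem_range_flow {x : Fin d → ℝ} {z : Fin N → ℝ}
    (h : ∀ i, z i ∈ Set.range (T.layer i (context x z i))) : z ∈ Set.range (T.flow x) := by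
  choose ε hε using h
  exact ⟨ε, T.eq_flow_of_forall fun i => (hε i).symm⟩

theorem flow_injective (x : Fin d → ℝ) : Function.Injective (T.flow x) := by
  intro ε ε' h
  funext i
  have hi := congrFun h i
  rw [flow_apply, flow_apply, h] at hi
  exact (T.strictMono_layer i _).injective hi

theorem contDiff_flow (x : Fin d → ℝ) : ContDiff ℝ 1 (T.flow x) := by
  rw [contDiff_pi]
  intro i
  induction i using WellFoundedLT.induction with
  | ind i ih =>
    have h : ContDiff ℝ 1 fun ε => (context x (T.flow x ε) i, ε i) := by
      refine ContDiff.prodMk (contDiff_pi.2 fun j => ?_) (contDiff_apply ℝ ℝ i)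
      refine Fin.addCases (fun a => ?_) (fun b => ?_) j
      · simpa [context] using contDiff_const
      · simpa [context] using ih ⟨b, b.isLt.trans i.isLt⟩ b.isLt
    have := (T.contDiff i).comp h
    simpa only [Function.comp_def, ← flow_apply] using this

/-- Reduces Jacobian entries to one-variable derivatives along `Function.update`, where the
recursion for the flow can be used directly. -/
theorem jacobian_flow_apply (x : Fin d → ℝ) (ε : Fin N → ℝ) (i j : Fin N) {c : ℝ}
    (h : HasDerivAt (fun t : ℝ => T.flow x (Function.update ε j t) i) c (ε j)) :
    jacobian (T.flow x) ε i j = c := by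
  have h1 : HasFDerivAt (T.flow x) (fderiv ℝ (T.flow x) ε) (Function.update ε j (ε j)) := by
    rw [Function.update_eq_self]
    exact ((T.contDiff_flow x).differentiable one_ne_zero ε).hasFDerivAt
  have h2 := (hasDerivAt_pi.1 (h1.comp_hasDerivAt (ε j) (hasDerivAt_update ε j (ε j)))) i
  rw [jacobian, LinearMap.toMatrix'_apply]
  have := h2.unique h
  simpa [Pi.single_apply] using this

theorem jacobian_flow_of_lt (x : Fin d → ℝ) (ε : Fin N → ℝ) {i j : Fin N} (hij : i < j) :
    jacobian (T.flow x) ε i j = 0 := by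
  refine T.jacobian_flow_apply x ε i j ?_
  have : (fun t : ℝ => T.flow x (Function.update ε j t) i) = fun _ => T.flow x ε i := by
    funext t
    exact T.flow_congr x i fun k hk => Function.update_of_ne (hk.trans_lt hij).ne _ _
  rw [this]
  exact hasDerivAt_const _ _

theorem jacobian_flow_self (x : Fin d → ℝ) (ε : Fin N → ℝ) (i : Fin N) :
    jacobian (T.flow x) ε i i = deriv (T.layer i (context x (T.flow x ε) i)) (ε i) := by
  refine T.jacobian_flow_apply x ε i i ?_
  have : (fun t : ℝ => T.flow x (Function.update ε i t) i) =
      T.layer i (context x (T.flow x ε) i) := by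
    funext t
    rw [flow_apply, Function.update_self]
    congr 1
    exact context_congr fun j hj => T.flow_congr x j fun k hk =>
      Function.update_of_ne (hk.trans_lt hj).ne _ _
  rw [this]
  exact T.hasDerivAt_layer i _ _

theorem isAutoregressiveFlow_flow (x : Fin d → ℝ) : IsAutoregressiveFlow (T.flow x) where
  contDiff := T.contDiff_flow x
  injective := T.flow_injective x
  autoregressive i _ _ h := T.flow_congr x i h
  lowerTriangular ε _ _ hij := T.jacobian_flow_of_lt x ε hij
  diag_pos ε i := by
    rw [jacobian_flow_self]
    exact T.deriv_pos i _ _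

theorem det_jacobian_flow (x : Fin d → ℝ) (ε : Fin N → ℝ) :
    (jacobian (T.flow x) ε).det =
      ∏ i, deriv (T.layer i (context x (T.flow x ε) i)) (ε i) := by
  rw [Matrix.det_of_isLowerTriangular _ fun i j hij => T.jacobian_flow_of_lt x ε hij]
  exact Finset.prod_congr rfl fun i _ => T.jacobian_flow_self x ε i

theorem measurable_flow (x : Fin d → ℝ) : Measurable (T.flow x) :=
  (T.contDiff_flow x).continuous.measurable

/-- The earlier latent variables are functions of the coordinates in `Finset.Iio i`, and disjoint
groups of coordinates are independent under a product measure. -/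
theorem indepFun_flow_eval (g : Fin N → Density ℝ) (x : Fin d → ℝ) (i : Fin N) :
    IndepFun (fun (ε : Fin N → ℝ) (j : Fin i) => T.flow x ε ⟨j, j.isLt.trans i.isLt⟩)
      (fun ε => ε i) (Measure.pi fun i => (g i).measure) := by
  have h0 : iIndepFun (fun (k : Fin N) (ε : Fin N → ℝ) => ε k)
      (Measure.pi fun i => (g i).measure) :=
    iIndepFun_pi (X := fun _ => id) fun _ => aemeasurable_id
  have h1 := h0.indepFun_finset (Finset.Iio i) {i} (by simp) fun k => measurable_pi_apply k
  -- The padding value `0` is immaterial: the outputs before `i` do not see these coordinates.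
  let ext : (Finset.Iio i → ℝ) → (Fin N → ℝ) := fun r k =>
    if hk : k ∈ Finset.Iio i then r ⟨k, hk⟩ else 0
  have hext : Measurable ext := by
    refine measurable_pi_lambda _ fun k => ?_
    by_cases hk : k ∈ Finset.Iio i
    · simpa only [ext, hk, dif_pos] using measurable_pi_apply _
    · simpa only [ext, hk, dif_neg, not_false_eq_true] using measurable_const
  have hφ : Measurable fun (r : Finset.Iio i → ℝ) (j : Fin i) =>
      T.flow x (ext r) ⟨j, j.isLt.trans i.isLt⟩ :=
    measurable_pi_lambda _ fun j => (measurable_pi_apply _).comp ((T.measurable_flow x).comp hext)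
  have h2 := h1.comp hφ (measurable_pi_apply (⟨i, Finset.mem_singleton_self i⟩ : ({i} : Finset _)))
  convert h2 using 1
  · funext ε j
    refine T.flow_congr x _ fun k hk => ?_
    have hki : k ∈ Finset.Iio i := Finset.mem_Iio.2 (lt_of_le_of_lt hk j.isLt)
    simp only [ext, dif_pos hki]
  · rfl

/-- Induction on `n`. By independence the pair of `z_{<n}` and the next noise has a product law;
applying the layer to its second component turns the product into the composition-product with
`condLaw`. -/
theorem lawUpTo_eq_map (g : Fin N → Density ℝ) (x : Fin d → ℝ) (n : ℕ) (h : n ≤ N) :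
    T.lawUpTo g x n h = (Measure.pi fun i => (g i).measure).map
      (fun ε (j : Fin n) => T.flow x ε ⟨j, j.isLt.trans_le h⟩) := by
  induction n with
  | zero =>
    rw [lawUpTo]
    have : (fun (ε : Fin N → ℝ) (j : Fin 0) => T.flow x ε ⟨j, j.isLt.trans_le h⟩) =
        fun _ => default := by
      funext ε; exact Subsingleton.elim _ _
    rw [this, Measure.map_const]
    simp
  | succ n ih =>
    have hn := Nat.le_of_succ_le h
    set P := Measure.pi fun i => (g i).measure
    let i : Fin N := ⟨n, h⟩
    have hZ : Measurable fun (ε : Fin N → ℝ) (j : Fin n) => T.flow x ε ⟨j, j.isLt.trans_le hn⟩ :=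
      measurable_pi_lambda _ fun j => (measurable_pi_apply _).comp (T.measurable_flow x)
    have hind := (indepFun_iff_map_prod_eq_prod_map_map hZ.aemeasurable
      (measurable_pi_apply i).aemeasurable).1 (T.indepFun_flow_eval g x i)
    have hmarg : P.map (fun ε => ε i) = (g i).measure := by
      exact (measurePreserving_eval (fun i => (g i).measure) i).map_eq
    have hlayer := T.measurable_layer x i
    have hpair : Measurable fun p : (Fin n → ℝ) × ℝ => (p.1, T.layer i (Fin.append x p.1) p.2) :=
      measurable_fst.prodMk hlayer
    have hsnoc : Measurable fun p : (Fin n → ℝ) × ℝ =>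
        (Fin.snoc (α := fun _ => ℝ) p.1 p.2 : Fin (n + 1) → ℝ) := by
      refine measurable_pi_lambda _ fun j => ?_
      refine Fin.lastCases ?_ (fun b => ?_) j
      · simpa using measurable_snd
      · simpa [Function.comp_def] using (measurable_pi_apply b).comp measurable_fst
    have hkernel : (P.map fun (ε : Fin N → ℝ) (j : Fin n) => T.flow x ε ⟨j, j.isLt.trans_le hn⟩) ⊗ₘ
        T.condLaw g x i = ((P.map fun (ε : Fin N → ℝ) (j : Fin n) =>
          T.flow x ε ⟨j, j.isLt.trans_le hn⟩).prod (g i).measure).map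
          (fun p => (p.1, T.layer i (Fin.append x p.1) p.2)) := by
      have : IsMarkovKernel (α := Fin n → ℝ) (T.condLaw g x i) :=
        instIsMarkovKernelCondLaw T g x i
      have : IsProbabilityMeasure (P.map fun (ε : Fin N → ℝ) (j : Fin n) =>
          T.flow x ε ⟨j, j.isLt.trans_le hn⟩) := Measure.isProbabilityMeasure_map hZ.aemeasurable
      ext s hs
      rw [Measure.compProd_apply hs, Measure.map_apply hpair hs,
        Measure.prod_apply (hpair hs)]
      refine lintegral_congr fun c => ?_
      exact Measure.map_apply (hlayer.comp (measurable_prodMk_left (x := c)))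
        (measurable_prodMk_left hs)
    rw [lawUpTo, ih hn]
    change Measure.map _ (_ ⊗ₘ T.condLaw g x i) = _
    rw [hkernel, Measure.map_map hsnoc hpair, ← hmarg]
    erw [← hind]
    rw [Measure.map_map (hsnoc.comp hpair) (hZ.prodMk (measurable_pi_apply i))]
    congr 1
    funext ε j
    refine Fin.lastCases ?_ (fun b => ?_) j
    · simp only [Function.comp_apply, Fin.snoc_last, Fin.val_last]
      exact (T.flow_apply x ε i).symm
    · simp

theorem law_eq_map_flow (g : Fin N → Density ℝ) (x : Fin d → ℝ) :
    (T.law g x : Measure (Fin N → ℝ)) =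
      (Measure.pi fun i => (g i).measure).map (T.flow x) :=
  T.lawUpTo_eq_map g x N le_rfl

/-- The graph map `(z_{<i}, e) ↦ (z_{<i}, layer i (x, z_{<i}) e)`. -/
def graph (x : Fin d → ℝ) (i : Fin N) (v : (Fin i → ℝ) × ℝ) : (Fin i → ℝ) × ℝ :=
  (v.1, T.layer i (Fin.append x v.1) v.2)

theorem contDiff_append_layer (x : Fin d → ℝ) (i : Fin N) :
    ContDiff ℝ 1 fun v : (Fin i → ℝ) × ℝ => T.layer i (Fin.append x v.1) v.2 := by
  have h : ContDiff ℝ 1 fun v : (Fin i → ℝ) × ℝ => Fin.append x v.1 := by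
    refine contDiff_pi.2 fun j => ?_
    refine Fin.addCases (fun a => ?_) (fun b => ?_) j
    · simpa only [Fin.append_left] using contDiff_const
    · simpa only [Fin.append_right, Function.comp_def] using
        (contDiff_apply ℝ ℝ b).comp contDiff_fst
  exact (T.contDiff i).comp (h.prodMk contDiff_snd)

theorem graph_injective (x : Fin d → ℝ) (i : Fin N) : Function.Injective (T.graph x i) := by
  rintro ⟨c, e⟩ ⟨c', e'⟩ h
  obtain ⟨rfl, h2⟩ := Prod.mk.inj h
  exact congrArg _ ((T.strictMono_layer i _).injective h2)

/-- Lusin–Souslin: a continuous injection of Polish spaces is a measurable embedding. This makes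
`condPdf`, an extension by zero off the range, jointly measurable. -/
theorem measurableEmbedding_graph (x : Fin d → ℝ) (i : Fin N) :
    MeasurableEmbedding (T.graph x i) :=
  (continuous_fst.prodMk (T.contDiff_append_layer x i).continuous).measurableEmbedding
    (T.graph_injective x i)

theorem deriv_layer_eq_fderiv (x : Fin d → ℝ) (i : Fin N) (v : (Fin i → ℝ) × ℝ) :
    deriv (T.layer i (Fin.append x v.1)) v.2 =
      fderiv ℝ (fun v : (Fin i → ℝ) × ℝ => T.layer i (Fin.append x v.1) v.2) v (0, 1) := by
  have h1 := (((T.contDiff_append_layer x i).differentiable one_ne_zero) v).hasFDerivAt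
  have h2 : HasDerivAt (fun t : ℝ => (v.1, t)) ((0 : Fin i → ℝ), (1 : ℝ)) v.2 :=
    (hasDerivAt_const _ _).prodMk (hasDerivAt_id _)
  exact (h1.comp_hasDerivAt v.2 h2).deriv

theorem measurable_deriv_layer (x : Fin d → ℝ) (i : Fin N) :
    Measurable fun v : (Fin i → ℝ) × ℝ => deriv (T.layer i (Fin.append x v.1)) v.2 := by
  simp only [deriv_layer_eq_fderiv]
  exact (((T.contDiff_append_layer x i).continuous_fderiv one_ne_zero).clm_apply
    continuous_const).measurable

/-- The density of layer `i` given the previous latent variables, as a joint function. -/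
def condPdf (g : Fin N → Density ℝ) (x : Fin d → ℝ) (i : Fin N) : (Fin i → ℝ) × ℝ → ℝ :=
  Function.extend (T.graph x i)
    (fun v => (g i).pdf v.2 / deriv (T.layer i (Fin.append x v.1)) v.2) 0

variable (g : Fin N → Density ℝ) (x : Fin d → ℝ)

theorem measurable_condPdf (i : Fin N) : Measurable (T.condPdf g x i) :=
  (T.measurableEmbedding_graph x i).measurable_extend
    (((g i).measurable_pdf.comp measurable_snd).div (T.measurable_deriv_layer x i))
    measurable_const

theorem condPdf_layer (i : Fin N) (c : Fin i → ℝ) (e : ℝ) :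
    T.condPdf g x i (c, T.layer i (Fin.append x c) e) =
      (g i).pdf e / deriv (T.layer i (Fin.append x c)) e :=
  (T.graph_injective x i).extend_apply _ _ (c, e)

theorem condPdf_of_notMem_range (i : Fin N) {c : Fin i → ℝ} {t : ℝ}
    (h : t ∉ Set.range (T.layer i (Fin.append x c))) : T.condPdf g x i (c, t) = 0 := by
  refine Function.extend_apply' _ _ _ ?_
  rintro ⟨⟨c', e⟩, he⟩
  obtain ⟨rfl, h2⟩ := Prod.mk.inj he
  exact h ⟨e, h2⟩

theorem condPdf_nonneg (i : Fin N) (v : (Fin i → ℝ) × ℝ) : 0 ≤ T.condPdf g x i v := by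
  obtain ⟨c, t⟩ := v
  by_cases h : t ∈ Set.range (T.layer i (Fin.append x c))
  · obtain ⟨e, rfl⟩ := h
    rw [condPdf_layer]
    exact div_nonneg ((g i).nonneg e) (T.deriv_pos i _ e).le
  · rw [T.condPdf_of_notMem_range g x i h]

theorem condLaw_eq_withDensity (i : Fin N) (c : Fin i → ℝ) :
    T.condLaw g x i c =
      volume.withDensity fun t => ENNReal.ofReal (T.condPdf g x i (c, t)) := by
  set τ := T.layer i (Fin.append x c) with hτ
  have hτm : Measurable τ := (T.contDiff_layer_right i _).continuous.measurable
  have hpdf : Measurable fun t => ENNReal.ofReal (T.condPdf g x i (c, t)) :=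
    ((T.measurable_condPdf g x i).comp measurable_prodMk_left).ennreal_ofReal
  ext s hs
  have hcov := lintegral_image_eq_lintegral_abs_deriv_mul MeasurableSet.univ
    (fun e _ => (T.hasDerivAt_layer i (Fin.append x c) e).hasDerivWithinAt)
    (T.strictMono_layer i (Fin.append x c)).injective.injOn
    (s.indicator fun t => ENNReal.ofReal (T.condPdf g x i (c, t)))
  rw [Set.image_univ, Measure.restrict_univ] at hcov
  have hzero : ∀ t ∉ Set.range τ,
      s.indicator (fun t => ENNReal.ofReal (T.condPdf g x i (c, t))) t = 0 := fun t ht => by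
    rw [Set.indicator_apply_eq_zero]
    intro _
    rw [T.condPdf_of_notMem_range g x i ht, ENNReal.ofReal_zero]
  -- The layer need not be surjective; since the density vanishes off its range, the change of
  -- variables formula over the range computes the full integral.
  rw [setLIntegral_eq_of_support_subset, lintegral_indicator hs,
    ← withDensity_apply _ hs] at hcov
  · rw [hcov]
    change (g i).measure.map τ s = _
    rw [Measure.map_apply hτm hs, Density.measure, withDensity_apply _ (hτm hs),
      ← lintegral_indicator (hτm hs)]
    refine lintegral_congr fun e => ?_
    by_cases he : τ e ∈ s
    · have hd := T.deriv_pos i (Fin.append x c) e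
      rw [Set.indicator_of_mem (show e ∈ τ ⁻¹' s from he), Set.indicator_of_mem he,
        condPdf_layer, ← ENNReal.ofReal_mul (abs_nonneg _), abs_of_pos hd,
        mul_div_cancel₀ _ hd.ne']
    · rw [Set.indicator_of_notMem (show e ∉ τ ⁻¹' s from he), Set.indicator_of_notMem he, mul_zero]
  · intro t ht
    by_contra h
    exact ht (hzero t h)

/-- The conditional density of layer `i` given the previous latent variables. -/
def condDensity (i : Fin N) (c : Fin i → ℝ) : Density ℝ where
  pdf t := T.condPdf g x i (c, t)
  measurable_pdf := (T.measurable_condPdf g x i).comp measurable_prodMk_left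
  nonneg t := T.condPdf_nonneg g x i _
  lintegral_eq_one := by
    have h : T.condLaw g x i c Set.univ = 1 := measure_univ
    rwa [condLaw_eq_withDensity, withDensity_apply _ MeasurableSet.univ,
      Measure.restrict_univ] at h

/-- The product of the conditional densities. -/
def jointPdf (z : Fin N → ℝ) : ℝ :=
  ∏ i : Fin N, T.condPdf g x i (fun j : Fin i => z ⟨j, j.isLt.trans i.isLt⟩, z i)

theorem measurable_jointPdf : Measurable (T.jointPdf g x) := by
  refine Finset.measurable_prod _ fun i _ => (T.measurable_condPdf g x i).comp ?_
  exact (measurable_pi_lambda _ fun j => measurable_pi_apply _).prodMk (measurable_pi_apply i)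

theorem jointPdf_nonneg (z : Fin N → ℝ) : 0 ≤ T.jointPdf g x z :=
  Finset.prod_nonneg fun i _ => T.condPdf_nonneg g x i _

/-- If every coordinate were attained by its layer, the noise could be solved for recursively; so
some factor vanishes. -/
theorem jointPdf_of_notMem_range {z : Fin N → ℝ} (h : z ∉ Set.range (T.flow x)) :
    T.jointPdf g x z = 0 := by
  obtain ⟨i, hi⟩ : ∃ i, z i ∉ Set.range (T.layer i (context x z i)) := by
    by_contra! hcon
    exact h (T.mem_range_flow hcon)
  exact Finset.prod_eq_zero (Finset.mem_univ i) (T.condPdf_of_notMem_range g x i hi)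

theorem jointPdf_flow_mul_det (ε : Fin N → ℝ) :
    T.jointPdf g x (T.flow x ε) * |(jacobian (T.flow x) ε).det| = ∏ i, (g i).pdf (ε i) := by
  rw [det_jacobian_flow, abs_of_pos (Finset.prod_pos fun i _ => T.deriv_pos i _ _), jointPdf,
    ← Finset.prod_mul_distrib]
  refine Finset.prod_congr rfl fun i _ => ?_
  have h := T.condPdf_layer g x i (fun j => T.flow x ε ⟨j, j.isLt.trans i.isLt⟩) (ε i)
  change T.condPdf g x i (_, T.layer i (context x (T.flow x ε) i) (ε i)) =
    _ / deriv (T.layer i (context x (T.flow x ε) i)) (ε i) at h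
  rw [← flow_apply] at h
  rw [h, div_mul_cancel₀ _ (T.deriv_pos i _ _).ne']

/-- Change of variables for the injective map `T.flow x`, with `jointPdf_flow_mul_det` cancelling
the determinant. -/
theorem law_eq_withDensity :
    (T.law g x : Measure (Fin N → ℝ)) =
      volume.withDensity fun z => ENNReal.ofReal (T.jointPdf g x z) := by
  ext s hs
  have hf := T.measurable_flow x
  have hcov := lintegral_image_eq_lintegral_abs_det_fderiv_mul volume MeasurableSet.univ
    (fun ε _ => ((T.contDiff_flow x).differentiable one_ne_zero ε).hasFDerivAt.hasFDerivWithinAt)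
    (T.flow_injective x).injOn
    (s.indicator fun z => ENNReal.ofReal (T.jointPdf g x z))
  rw [Set.image_univ, Measure.restrict_univ] at hcov
  rw [setLIntegral_eq_of_support_subset, lintegral_indicator hs, ← withDensity_apply _ hs] at hcov
  · rw [hcov, law_eq_map_flow, Measure.map_apply hf hs, Density.pi_measure_eq_withDensity,
      withDensity_apply _ (hf hs), ← lintegral_indicator (hf hs)]
    refine lintegral_congr fun ε => ?_
    by_cases he : T.flow x ε ∈ s
    · rw [Set.indicator_of_mem (show ε ∈ T.flow x ⁻¹' s from he), Set.indicator_of_mem he,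
        ← ENNReal.ofReal_mul (abs_nonneg _), ← T.jointPdf_flow_mul_det g x ε, mul_comm,
        jacobian, LinearMap.det_toMatrix']
    · rw [Set.indicator_of_notMem (show ε ∉ T.flow x ⁻¹' s from he),
        Set.indicator_of_notMem he, mul_zero]
  · intro z hz
    by_contra h
    refine hz ?_
    rw [Set.indicator_apply_eq_zero]
    intro _
    rw [T.jointPdf_of_notMem_range g x h, ENNReal.ofReal_zero]

/-- The density of the top-down distribution. -/
def density : Density (Fin N → ℝ) where
  pdf := T.jointPdf g x
  measurable_pdf := T.measurable_jointPdf g x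
  nonneg := T.jointPdf_nonneg g x
  lintegral_eq_one := by
    have h : (T.law g x : Measure (Fin N → ℝ)) Set.univ = 1 := measure_univ
    rwa [law_eq_withDensity, withDensity_apply _ MeasurableSet.univ, Measure.restrict_univ] at h

theorem isFlow : T.IsFlow g x where
  isAutoregressiveFlow := T.isAutoregressiveFlow_flow x
  surjective h z := T.mem_range_flow fun i => h i _ (z i)
  law_eq_map := T.law_eq_map_flow g x
  exists_density := ⟨T.condDensity g x, T.density g x, T.measurable_condPdf g x,
    T.condLaw_eq_withDensity g x, fun _ => rfl, Subtype.ext (T.law_eq_withDensity g x),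
    T.jointPdf_flow_mul_det g x⟩

end TopDown

/-! ### Sigmoids as approximate step functions. -/

namespace IsSigmoid

variable {σ : ℝ → ℝ} (hσ : IsSigmoid σ)
include hσ

theorem strictMono : StrictMono σ := strictMono_of_deriv_pos hσ.deriv_pos

theorem continuous : Continuous σ := hσ.contDiff.continuous

theorem pos (t : ℝ) : 0 < σ t :=
  (hσ.strictMono.monotone.le_of_tendsto hσ.tendsto_atBot (t - 1)).trans_lt
    (hσ.strictMono (sub_one_lt t))

theorem lt_one (t : ℝ) : σ t < 1 :=
  (hσ.strictMono (lt_add_one t)).trans_le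
    (hσ.strictMono.monotone.ge_of_tendsto hσ.tendsto_atTop (t + 1))

/-- Outside a large interval, a sigmoid is close to the unit step. -/
theorem exists_forall_close_step {η : ℝ} (hη : 0 < η) :
    ∃ B > 0, (∀ t, B ≤ t → 1 - σ t ≤ η) ∧ ∀ t, t ≤ -B → σ t ≤ η := by
  obtain ⟨B₁, hB₁⟩ := eventually_atTop.1
    (hσ.tendsto_atTop.eventually (lt_mem_nhds (show 1 - η < 1 by linarith)))
  obtain ⟨B₂, hB₂⟩ := eventually_atBot.1 (hσ.tendsto_atBot.eventually (gt_mem_nhds hη))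
  refine ⟨max 1 (max B₁ (-B₂)), by positivity, fun t ht => ?_, fun t ht => ?_⟩
  · have := hB₁ t (((le_max_left _ _).trans (le_max_right _ _)).trans ht)
    linarith
  · have h : -B₂ ≤ max 1 (max B₁ (-B₂)) := (le_max_right _ _).trans (le_max_right _ _)
    exact (hB₂ t (by linarith)).le

/-- Continuous functions are uniformly approximated on bounded intervals by staircases of
sigmoids. -/
theorem exists_staircase {f : ℝ → ℝ} (hf : Continuous f) {R : ℝ} (hR : 0 < R) {ε : ℝ}
    (hε : 0 < ε) :
    ∃ (n : ℕ) (A c : ℝ) (s j : ℕ → ℝ), ∀ t, |t| ≤ R →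
      |f t - (c + ∑ k ∈ Finset.range n, j k * σ (A * (t - s k)))| ≤ ε := by
  obtain ⟨δ, hδ, hfδ⟩ := Metric.uniformContinuousOn_iff_le.1
    (isCompact_Icc.uniformContinuousOn_of_continuous (s := Set.Icc (-R) R) hf.continuousOn)
    (ε / 3) (by positivity)
  obtain ⟨n, hn⟩ := exists_nat_gt (2 * R / δ)
  have hn0 : (0 : ℝ) < n := lt_of_le_of_lt (by positivity) hn
  set h := 2 * R / n with hh
  have hh0 : 0 < h := by positivity
  have hhδ : h ≤ δ := by
    rw [div_lt_iff₀ hδ] at hn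
    rw [hh, div_le_iff₀ hn0]
    linarith
  have hnh : n * h = 2 * R := by rw [hh]; field_simp
  let p : ℕ → ℝ := fun k => -R + k * h
  -- Tolerance `1 / n` per sigmoid, so that the errors of all `n` steps together cost at most one
  -- jump bound `ε / 3`.
  obtain ⟨B, hB, hB1, hB0⟩ := hσ.exists_forall_close_step (show (0 : ℝ) < 1 / n by positivity)
  have hp_mem : ∀ k ≤ n, p k ∈ Set.Icc (-R) R := fun k hk => by
    have hk' : (k : ℝ) ≤ n := by exact_mod_cast hk
    have : (k : ℝ) * h ≤ n * h := by gcongr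
    constructor <;> simp only [p] <;> nlinarith [mul_nonneg (Nat.cast_nonneg (α := ℝ) k) hh0.le]
  have hjump : ∀ k < n, |f (p (k + 1)) - f (p k)| ≤ ε / 3 := fun k hk => by
    refine hfδ _ (hp_mem _ hk) _ (hp_mem _ hk.le) ?_
    rw [Real.dist_eq]
    simp only [p]
    push_cast
    rw [show -R + ((k : ℝ) + 1) * h - (-R + k * h) = h by ring, abs_of_pos hh0]
    exact hhδ
  -- The steps are centred in the cells of the grid; with slope `2 * B / h`, half a cell corresponds
  -- to the argument `B`.
  refine ⟨n, 2 * B / h, f (p 0), fun k => p k + h / 2, fun k => f (p (k + 1)) - f (p k),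
    fun t ht => ?_⟩
  rw [abs_le] at ht
  set l := ⌊(t + R) / h⌋₊ with hl
  have hnn : 0 ≤ (t + R) / h := div_nonneg (by linarith) hh0.le
  have hl1 : p l ≤ t := by
    have := Nat.floor_le hnn
    rw [← hl, le_div_iff₀ hh0] at this
    simp only [p]; linarith
  have hl2 : t < p l + h := by
    have := Nat.lt_floor_add_one ((t + R) / h)
    rw [← hl, div_lt_iff₀ hh0] at this
    simp only [p]; linarith
  have hln : l ≤ n := by
    have : (l : ℝ) * h ≤ n * h := by simp only [p] at hl1; linarith
    exact_mod_cast le_of_mul_le_mul_right this hh0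
  have htl : |f t - f (p l)| ≤ ε / 3 := by
    refine hfδ _ ⟨ht.1, ht.2⟩ _ (hp_mem _ hln) ?_
    rw [Real.dist_eq, abs_of_nonneg (by linarith)]
    linarith
  have htel : f (p l) = f (p 0) +
      ∑ k ∈ Finset.range n, (f (p (k + 1)) - f (p k)) * (if k < l then 1 else 0) := by
    have hfilter : (Finset.range n).filter (· < l) = Finset.range l := by
      ext k
      simp only [Finset.mem_filter, Finset.mem_range]
      omega
    simp only [mul_ite, mul_one, mul_zero]
    rw [← Finset.sum_filter, hfilter, Finset.sum_range_sub (fun k => f (p k))]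
    ring
  -- Only the step in the cell of `t` itself can be in transition; there the trivial bound `1` is
  -- used.
  have hterm : ∀ k ∈ Finset.range n,
      |(f (p (k + 1)) - f (p k)) * (if k < l then 1 else 0) -
        (f (p (k + 1)) - f (p k)) * σ (2 * B / h * (t - (p k + h / 2)))| ≤
      ε / 3 * (1 / n + if k = l then 1 else 0) := by
    intro k hk
    rw [← mul_sub, abs_mul]
    refine mul_le_mul (hjump k (Finset.mem_range.1 hk)) ?_ (abs_nonneg _) (by positivity)
    have hσ0 := hσ.pos (2 * B / h * (t - (p k + h / 2)))
    have hσ1 := hσ.lt_one (2 * B / h * (t - (p k + h / 2)))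
    have hBh : 2 * B / h * (h / 2) = B := by field_simp
    rcases lt_trichotomy k l with hkl | hkl | hkl
    · have h1 : ((k : ℝ) + 1) * h ≤ l * h := by
        have : (k : ℝ) + 1 ≤ l := by exact_mod_cast hkl
        gcongr
      have h2 := hB1 (2 * B / h * (t - (p k + h / 2))) (by
        refine hBh.symm.le.trans ?_
        refine mul_le_mul_of_nonneg_left ?_ (show 0 ≤ 2 * B / h by positivity)
        simp only [p] at hl1 ⊢
        linarith)
      rw [if_pos hkl, if_neg hkl.ne, abs_of_pos (by linarith)]
      linarith
    · rw [if_neg (by omega), if_pos hkl, zero_sub, abs_neg, abs_of_pos hσ0]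
      have : (0 : ℝ) < 1 / n := by positivity
      linarith
    · have h1 : ((l : ℝ) + 1) * h ≤ k * h := by
        have : (l : ℝ) + 1 ≤ k := by exact_mod_cast hkl
        gcongr
      have h2 := hB0 (2 * B / h * (t - (p k + h / 2))) (by
        refine le_trans ?_ (show 2 * B / h * -(h / 2) ≤ -B by rw [mul_neg, hBh])
        refine mul_le_mul_of_nonneg_left ?_ (show 0 ≤ 2 * B / h by positivity)
        simp only [p] at hl2 ⊢
        linarith)
      rw [if_neg (by omega), if_neg hkl.ne', zero_sub, abs_neg, abs_of_pos hσ0]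
      linarith
  have hsum : |f (p l) - (f (p 0) + ∑ k ∈ Finset.range n,
      (f (p (k + 1)) - f (p k)) * σ (2 * B / h * (t - (p k + h / 2))))| ≤ ε / 3 * 2 := by
    rw [htel, add_sub_add_left_eq_sub, ← Finset.sum_sub_distrib]
    refine (Finset.abs_sum_le_sum_abs _ _).trans ((Finset.sum_le_sum hterm).trans ?_)
    rw [← Finset.mul_sum, Finset.sum_add_distrib, Finset.sum_ite_eq']
    refine mul_le_mul_of_nonneg_left ?_ (by positivity)
    simp only [Finset.sum_const, Finset.card_range, nsmul_eq_mul]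
    have : (n : ℝ) * (1 / n) = 1 := by field_simp
    rw [this]
    split_ifs <;> norm_num
  have := (abs_sub_le (f t) (f (p l)) _).trans (add_le_add htl hsum)
  linarith

end IsSigmoid

/-! ### Universal approximation by feedforward networks. -/

section UniversalApproximation

variable {m : ℕ} {Y : Set (Fin m → ℝ)}

/-- The ridge function `c ↦ f (w ⬝ c + b)`. -/
def ridge (Y : Set (Fin m → ℝ)) {f : ℝ → ℝ} (hf : Continuous f) (v : (Fin m → ℝ) × ℝ) :
    C(Y, ℝ) :=
  ⟨fun c => f (v.1 ⬝ᵥ (c : Fin m → ℝ) + v.2), by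
    refine hf.comp ?_
    exact (continuous_const.dotProduct continuous_subtype_val).add continuous_const⟩

theorem ridge_apply {f : ℝ → ℝ} (hf : Continuous f) (v : (Fin m → ℝ) × ℝ) (c : Y) :
    ridge Y hf v c = f (v.1 ⬝ᵥ (c : Fin m → ℝ) + v.2) := rfl

/-- Products of exponential ridge functions are again such functions, so their span is already an
algebra; it separates points, and Stone–Weierstrass applies. -/
theorem span_exp_ridge_dense [CompactSpace Y] :
    (Submodule.span ℝ (Set.range (ridge Y Real.continuous_exp))).topologicalClosure = ⊤ := by
  let S : Submonoid C(Y, ℝ) :=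
    { carrier := Set.range (ridge Y Real.continuous_exp)
      one_mem' := ⟨0, by ext c; simp [ridge_apply]⟩
      mul_mem' := by
        rintro _ _ ⟨v, rfl⟩ ⟨w, rfl⟩
        refine ⟨v + w, ?_⟩
        ext c
        simp only [ridge_apply, ContinuousMap.mul_apply, ← Real.exp_add]
        congr 1
        simp only [Prod.fst_add, Prod.snd_add, add_dotProduct]
        ring }
  let A := Algebra.adjoin ℝ (S : Set C(Y, ℝ))
  have hA : Subalgebra.toSubmodule A =
      Submodule.span ℝ (Set.range (ridge Y Real.continuous_exp)) := by
    rw [Algebra.adjoin_eq_span, Submonoid.closure_eq]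
    rfl
  have hsep : A.SeparatesPoints := by
    intro c c' hne
    obtain ⟨i, hi⟩ : ∃ i, (c : Fin m → ℝ) i ≠ (c' : Fin m → ℝ) i := by
      by_contra! h
      exact hne (Subtype.ext (funext h))
    refine ⟨_, ⟨ridge Y Real.continuous_exp (Pi.single i 1, 0),
      Algebra.subset_adjoin ⟨_, rfl⟩, rfl⟩, ?_⟩
    simpa [ridge_apply] using hi
  have hdense := ContinuousMap.subalgebra_topologicalClosure_eq_top_of_separatesPoints A hsep
  rw [← hA]
  refine SetLike.coe_injective ?_
  have := congrArg (fun B : Subalgebra ℝ C(Y, ℝ) => (B : Set C(Y, ℝ))) hdense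
  simpa using this

/-- An exponential ridge function is `exp` of an affine function with bounded range on `Y`.
Replacing `exp` by a staircase of sigmoids on that range gives a combination of sigmoid ridge
functions. -/
theorem span_ridge_dense {σ : ℝ → ℝ} (hσ : IsSigmoid σ) [CompactSpace Y] :
    (Submodule.span ℝ (Set.range (ridge Y hσ.continuous))).topologicalClosure = ⊤ := by
  set V := Submodule.span ℝ (Set.range (ridge Y hσ.continuous)) with hV
  have hone : (1 : C(Y, ℝ)) ∈ V := by
    have h : (1 : C(Y, ℝ)) = (σ 0)⁻¹ • ridge Y hσ.continuous 0 := by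
      ext c
      simp [ridge_apply, (hσ.pos 0).ne']
    rw [h]
    exact V.smul_mem _ (Submodule.subset_span ⟨_, rfl⟩)
  rw [eq_top_iff, ← span_exp_ridge_dense]
  refine Submodule.topologicalClosure_minimal _ (Submodule.span_le.2 ?_)
    V.isClosed_topologicalClosure
  rintro _ ⟨v, rfl⟩
  refine Metric.mem_closure_iff.2 fun ε hε => ?_
  let u : C(Y, ℝ) := ridge Y continuous_id v
  obtain ⟨n, A, c, s, j, hst⟩ := hσ.exists_staircase Real.continuous_exp
    (R := ‖u‖ + 1) (by positivity) (half_pos hε)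
  refine ⟨c • 1 + ∑ k ∈ Finset.range n,
    j k • ridge Y hσ.continuous (A • v.1, A * (v.2 - s k)), ?_, ?_⟩
  · exact V.add_mem (V.smul_mem _ hone) (V.sum_mem fun k _ => V.smul_mem _
      (Submodule.subset_span ⟨_, rfl⟩))
  · refine ((ContinuousMap.dist_le (half_pos hε).le).2 ?_).trans_lt (half_lt_self hε)
    intro y
    have huy : |u y| ≤ ‖u‖ + 1 := (u.norm_coe_le_norm y).trans (by linarith)
    convert hst (u y) huy using 1
    rw [Real.dist_eq]
    congr 2
    simp only [ContinuousMap.add_apply, ContinuousMap.smul_apply, ContinuousMap.one_apply,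
      smul_eq_mul, mul_one, ContinuousMap.sum_apply, ridge_apply, smul_dotProduct]
    congr 1
    refine Finset.sum_congr rfl fun k _ => ?_
    congr 2
    simp only [u, ridge_apply, id]
    ring

/-- **Universal approximation theorem**: networks with one hidden layer approximate continuous
functions uniformly on compact sets. -/
theorem MLP.exists_approx {σ : ℝ → ℝ} (hσ : IsSigmoid σ) (hY : IsCompact Y) {k : ℕ}
    {f : (Fin m → ℝ) → Fin k → ℝ} (hf : ContinuousOn f Y) {ε : ℝ} (hε : 0 < ε) :
    ∃ M : MLP k m, ∀ c ∈ Y, ∀ i, |M.eval σ c i - f c i| ≤ ε := by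
  have : CompactSpace Y := isCompact_iff_compactSpace.1 hY
  have happ : ∀ i : Fin k, ∃ a : ((Fin m → ℝ) × ℝ) →₀ ℝ, ∀ c : Y,
      |(a.sum fun v r => r • ridge Y hσ.continuous v) c - f c i| ≤ ε := fun i => by
    let F : C(Y, ℝ) := ⟨fun c => f c i,
      (continuous_apply i).comp (continuousOn_iff_continuous_domRestrict.1 hf)⟩
    have hF : F ∈ (Submodule.span ℝ (Set.range (ridge Y hσ.continuous))).topologicalClosure := by
      rw [span_ridge_dense hσ]
      trivial
    obtain ⟨h, hh, hd⟩ := Metric.mem_closure_iff.1 hF ε hε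
    obtain ⟨a, rfl⟩ := Finsupp.mem_span_range_iff_exists_finsupp.1 hh
    refine ⟨a, fun c => ?_⟩
    rw [← Real.dist_eq, dist_comm]
    exact (ContinuousMap.dist_apply_le_dist (f := F) c).trans hd.le
  choose a ha using happ
  classical
  -- All outputs share one hidden layer, with a unit for every ridge function used by any of them.
  let U : Finset ((Fin m → ℝ) × ℝ) := Finset.univ.biUnion fun i => (a i).support
  let e := U.equivFin
  refine ⟨.hidden U.card (Matrix.of fun i => (e.symm i).1.1) (fun i => (e.symm i).1.2)
    (.output (Matrix.of fun i l => a i (e.symm l).1) 0), fun c hc i => ?_⟩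
  convert ha i ⟨c, hc⟩ using 3
  rw [Finsupp.sum_of_support_subset (s := U) _
    (Finset.subset_biUnion_of_mem (fun i => (a i).support) (Finset.mem_univ i)) _ (by simp)]
  simp only [MLP.eval, Matrix.mulVec, dotProduct, Matrix.of_apply,
    ContinuousMap.sum_apply, ContinuousMap.smul_apply, smul_eq_mul, ridge_apply, Pi.add_apply, Pi.zero_apply, add_zero]
  rw [← Finset.sum_coe_sort U, ← e.symm.sum_comp]

theorem MLP.contDiff_eval {σ : ℝ → ℝ} (hσ : ContDiff ℝ 1 σ) {k : ℕ} (M : MLP k m) :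
    ContDiff ℝ 1 (M.eval σ) := by
  induction M with
  | output W b =>
    refine contDiff_pi.2 fun i => ?_
    simp only [MLP.eval, Matrix.mulVec, dotProduct, Pi.add_apply]
    fun_prop
  | hidden w W b next ih =>
    refine ih.comp (contDiff_pi.2 fun i => hσ.comp ?_)
    simp only [Matrix.mulVec, dotProduct, Pi.add_apply]
    fun_prop

end UniversalApproximation

/-! ### Neural layers are admissible reparameterized layers. -/

namespace NeuralLayer

variable {m : ℕ} {σ : ℝ → ℝ} (hσ : IsSigmoid σ) (L : NeuralLayer m)
include hσ

theorem contDiff_eval :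
    ContDiff ℝ 1 fun v : (Fin m → ℝ) × ℝ => L.eval σ v.1 v.2 := by
  have h : ∀ {k : ℕ} (M : MLP k m) (i : Fin k),
      ContDiff ℝ 1 fun v : (Fin m → ℝ) × ℝ => M.eval σ v.1 i := fun M i =>
    (contDiff_apply ℝ ℝ i).comp ((M.contDiff_eval hσ.contDiff).comp contDiff_fst)
  refine ContDiff.add (ContDiff.add (h _ _) ((h _ _).exp.mul contDiff_snd))
    (ContDiff.sum fun k _ => (h _ _).exp.mul (hσ.contDiff.comp ?_))
  exact ((h _ _).exp.mul contDiff_snd).add (h _ _)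

theorem deriv_eval_pos (c : Fin m → ℝ) (e : ℝ) : 0 < deriv (L.eval σ c) e := by
  have h : HasDerivAt (L.eval σ c) (0 + Real.exp (L.logScale.eval σ c 0) * 1 +
      ∑ k : Fin L.K, Real.exp (L.logHeight.eval σ c k) *
        (deriv σ (Real.exp (L.logSlope.eval σ c k) * e + L.offset.eval σ c k) *
          (Real.exp (L.logSlope.eval σ c k) * 1))) e := by
    refine HasDerivAt.add (((hasDerivAt_const e _).add ((hasDerivAt_id e).const_mul _)))
      (HasDerivAt.fun_sum fun k _ => HasDerivAt.const_mul _ ?_)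
    have h1 := (hσ.contDiff.differentiable one_ne_zero
      (Real.exp (L.logSlope.eval σ c k) * e + L.offset.eval σ c k)).hasDerivAt
    exact h1.comp e (((hasDerivAt_id e).const_mul _).add_const _)
  rw [h.deriv]
  have hsum : 0 ≤ ∑ k : Fin L.K, Real.exp (L.logHeight.eval σ c k) *
        (deriv σ (Real.exp (L.logSlope.eval σ c k) * e + L.offset.eval σ c k) *
          (Real.exp (L.logSlope.eval σ c k) * 1)) :=
    Finset.sum_nonneg fun k _ => by
      have := hσ.deriv_pos (Real.exp (L.logSlope.eval σ c k) * e + L.offset.eval σ c k)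
      positivity
  have := Real.exp_pos (L.logScale.eval σ c 0)
  linarith

end NeuralLayer

/-- The top-down distribution with given neural layers. -/
def TopDown.ofNeural {d N : ℕ} {σ : ℝ → ℝ} (hσ : IsSigmoid σ)
    (L : (i : Fin N) → NeuralLayer (d + i)) : TopDown d N where
  layer i c e := (L i).eval σ c e
  contDiff i := (L i).contDiff_eval hσ
  deriv_pos i c e := (L i).deriv_eval_pos hσ c e

theorem TopDown.isNeural_ofNeural {d N : ℕ} {σ : ℝ → ℝ} (hσ : IsSigmoid σ)
    (L : (i : Fin N) → NeuralLayer (d + i)) : (TopDown.ofNeural hσ L).IsNeural σ :=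
  ⟨L, fun _ _ _ => rfl⟩

/-! ### Noise intervals with prescribed, continuously varying probabilities. -/

section Thresholds

theorem ProbabilityTheory.continuous_cdf (γ : Measure ℝ) [IsProbabilityMeasure γ]
    [NullSingletonClass γ] : Continuous (cdf γ) := by
  refine continuous_iff_continuousAt.2 fun t => ?_
  rw [(cdf γ).mono.continuousAt_iff_leftLim_eq_rightLim, StieltjesFunction.rightLim_eq]
  have h : (cdf γ).measure {t} = 0 := by rw [measure_cdf]; exact measure_singleton t
  rw [StieltjesFunction.measure_singleton, ENNReal.ofReal_eq_zero] at h
  exact le_antisymm ((cdf γ).mono.leftLim_le le_rfl) (by linarith)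

/-- A continuous monotone approximate quantile function. -/
theorem exists_approx_quantile (γ : Measure ℝ) [IsProbabilityMeasure γ] [NullSingletonClass γ]
    {σ : ℝ → ℝ} (hσ : IsSigmoid σ) {δ : ℝ} (hδ : 0 < δ) (hδ1 : δ ≤ 1) :
    ∃ q : ℝ → ℝ, MonotoneOn q (Set.Ioo 0 1) ∧ ContinuousOn q (Set.Ioo 0 1) ∧
      ∀ v ∈ Set.Ioo (0 : ℝ) 1, |cdf γ (q v) - v| ≤ δ := by
  -- The distribution function may have flat pieces, which make its quantile function jump. Mixing
  -- in a little of `σ` makes it strictly increasing with a continuous inverse, at an error of at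
  -- most `δ`.
  let G : ℝ → ℝ := fun t => (1 - δ) * cdf γ t + δ * σ t
  have hGc : Continuous G := (continuous_const.mul (continuous_cdf γ)).add
    (continuous_const.mul hσ.continuous)
  have hGm : StrictMono G := fun s t hst =>
    add_lt_add_of_le_of_lt
      (mul_le_mul_of_nonneg_left (monotone_cdf γ hst.le) (sub_nonneg.2 hδ1))
      (mul_lt_mul_of_pos_left (hσ.strictMono hst) hδ)
  have hG0 : Tendsto G atBot (𝓝 0) := by
    simpa using ((tendsto_cdf_atBot γ).const_mul (1 - δ)).add (hσ.tendsto_atBot.const_mul δ)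
  have hG1 : Tendsto G atTop (𝓝 1) := by
    simpa using ((tendsto_cdf_atTop γ).const_mul (1 - δ)).add (hσ.tendsto_atTop.const_mul δ)
  have hGmem : ∀ t, G t ∈ Set.Ioo (0 : ℝ) 1 := fun t =>
    ⟨(hGm.monotone.le_of_tendsto hG0 (t - 1)).trans_lt (hGm (sub_one_lt t)),
      (hGm (lt_add_one t)).trans_le (hGm.monotone.ge_of_tendsto hG1 (t + 1))⟩
  let F : ℝ → Set.Ioo (0 : ℝ) 1 := fun t => ⟨G t, hGmem t⟩
  have hFs : Function.Surjective F := fun ⟨v, hv⟩ => by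
    obtain ⟨t, ht⟩ := mem_range_of_exists_le_of_exists_ge hGc
      ((hG0.eventually (gt_mem_nhds hv.1)).exists.imp fun _ h => h.le)
      ((hG1.eventually (lt_mem_nhds hv.2)).exists.imp fun _ h => h.le)
    exact ⟨t, Subtype.ext ht⟩
  let e : ℝ ≃o Set.Ioo (0 : ℝ) 1 :=
    StrictMono.orderIsoOfSurjective F (fun _ _ h => hGm h) hFs
  have hGe : ∀ v, G (e.symm v) = v := fun v => congrArg Subtype.val (e.apply_symm_apply v)
  refine ⟨fun v => if hv : v ∈ Set.Ioo (0 : ℝ) 1 then e.symm ⟨v, hv⟩ else 0, ?_, ?_, ?_⟩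
  · intro v hv w hw hvw
    simp only [dif_pos hv, dif_pos hw]
    exact e.symm.monotone hvw
  · rw [continuousOn_iff_continuous_domRestrict]
    refine e.symm.continuous.congr fun v => ?_
    change e.symm v = dite _ _ _
    rw [dif_pos v.2]
  · intro v hv
    simp only [dif_pos hv]
    have h := hGe ⟨v, hv⟩
    set t := e.symm ⟨v, hv⟩
    have h1 : cdf γ t - v = δ * (cdf γ t - σ t) := by
      change (1 - δ) * cdf γ t + δ * σ t = v at h
      rw [← h]; ring
    rw [h1, abs_mul, abs_of_pos hδ]
    refine mul_le_of_le_one_right hδ.le (abs_le.2 ?_)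
    have := cdf_nonneg γ t
    have := cdf_le_one γ t
    have := hσ.pos t
    have := hσ.lt_one t
    constructor <;> linarith

/-- Continuously varying weights are realized by intervals with continuously varying end points
and a gap in between. -/
theorem exists_thresholds (γ : Measure ℝ) [IsProbabilityMeasure γ] [NullSingletonClass γ]
    {σ : ℝ → ℝ} (hσ : IsSigmoid σ) {X : Type*} [TopologicalSpace X] {K : Set X} {m : ℕ}
    {W : X → ℕ → ℝ} (hW : ∀ k, ContinuousOn (fun x => W x k) K) (hW0 : ∀ x ∈ K, ∀ k, 0 ≤ W x k)
    (hW1 : ∀ x ∈ K, ∑ k ∈ Finset.range m, W x k = 1) {δ : ℝ} (hδ : 0 < δ) :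
    ∃ (t : X → ℕ → ℝ) (η : ℝ), 0 < η ∧ (∀ k ≤ m, ContinuousOn (fun x => t x k) K) ∧
      (∀ x ∈ K, ∀ k l, k ≤ l → l ≤ m → t x k ≤ t x l) ∧
      ∀ x ∈ K, ∀ k < m, W x k - δ ≤ γ.real (Set.Icc (t x k + 2 * η) (t x (k + 1) - 2 * η)) := by
  -- Loss of `6 * κ`: at each end point `κ` from the approximate quantile and `κ` from the gap, and
  -- `2 * κ` from rescaling the weights.
  obtain ⟨κ, hκ, hκ4, hκδ⟩ : ∃ κ : ℝ, 0 < κ ∧ κ ≤ 1 / 4 ∧ 6 * κ ≤ δ :=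
    ⟨min (1 / 4) (δ / 6), by positivity, min_le_left _ _, by
      have := min_le_right (1 / 4) (δ / 6); linarith⟩
  obtain ⟨q, hqm, hqc, hq⟩ := exists_approx_quantile γ hσ hκ (by linarith)
  -- Squeezing the cumulative weights into `[κ, 1 - κ]` keeps the thresholds in a fixed compact
  -- interval; uniform continuity of the distribution function there gives one gap `η` for all `x`.
  let v : X → ℕ → ℝ := fun x k => (1 - 2 * κ) * (∑ l ∈ Finset.range k, W x l) + κ
  have hv0 : ∀ x, v x 0 = κ := fun x => by simp [v]
  have hvm : ∀ x ∈ K, v x m = 1 - κ := fun x hx => by simp only [v, hW1 x hx]; ring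
  have hvmono : ∀ x ∈ K, Monotone (v x) := fun x hx k l hkl => by
    have h : ∑ j ∈ Finset.range k, W x j ≤ ∑ j ∈ Finset.range l, W x j :=
      Finset.sum_le_sum_of_subset_of_nonneg (Finset.range_mono hkl) fun j _ _ => hW0 x hx j
    have h2 : 0 ≤ 1 - 2 * κ := by linarith
    simp only [v]
    gcongr
  have hvI : ∀ x ∈ K, ∀ k ≤ m, v x k ∈ Set.Icc κ (1 - κ) := fun x hx k hk =>
    ⟨(hv0 x).symm.le.trans (hvmono x hx (Nat.zero_le k)), (hvmono x hx hk).trans (hvm x hx).le⟩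
  have hsub : Set.Icc κ (1 - κ) ⊆ Set.Ioo 0 1 := Set.Icc_subset_Ioo hκ (by linarith)
  have hκI : κ ∈ Set.Icc κ (1 - κ) := ⟨le_rfl, by linarith⟩
  have hκI' : 1 - κ ∈ Set.Icc κ (1 - κ) := ⟨by linarith, le_rfl⟩
  have htI : ∀ x ∈ K, ∀ k ≤ m, q (v x k) ∈ Set.Icc (q κ) (q (1 - κ)) := fun x hx k hk =>
    ⟨hqm (hsub hκI) (hsub (hvI x hx k hk)) (hvI x hx k hk).1,
      hqm (hsub (hvI x hx k hk)) (hsub hκI') (hvI x hx k hk).2⟩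
  obtain ⟨r, hr, hunif⟩ := Metric.uniformContinuousOn_iff_le.1
    ((isCompact_Icc (a := q κ - 1) (b := q (1 - κ) + 1)).uniformContinuousOn_of_continuous
      (continuous_cdf γ).continuousOn) κ hκ
  obtain ⟨η, hη, hη1, hηr⟩ : ∃ η : ℝ, 0 < η ∧ 2 * η ≤ 1 ∧ 2 * η ≤ r :=
    ⟨min (1 / 2) (r / 2), by positivity, by
      have := min_le_left (1 / 2) (r / 2); linarith, by
      have := min_le_right (1 / 2) (r / 2); linarith⟩
  refine ⟨fun x k => q (v x k), η, hη, fun k hk => ?_, fun x hx k l hkl hl => ?_,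
    fun x hx k hk => ?_⟩
  · refine hqc.comp ?_ fun x hx => hsub (hvI x hx k hk)
    exact (continuousOn_const.mul (continuousOn_finsetSum _ fun l _ => hW l)).add
      continuousOn_const
  · exact hqm (hsub (hvI x hx k (hkl.trans hl))) (hsub (hvI x hx l hl)) (hvmono x hx hkl)
  · have hk' : k + 1 ≤ m := hk
    set a := q (v x k) with ha
    set b := q (v x (k + 1)) with hb
    have haI := htI x hx k hk.le
    have hbI := htI x hx (k + 1) hk'
    rw [← ha] at haI
    rw [← hb] at hbI
    have h1 : cdf γ (a + 2 * η) ≤ v x k + 2 * κ := by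
      have h := hunif (a + 2 * η) ⟨by linarith [haI.1], by linarith [haI.2]⟩ a
        ⟨by linarith [haI.1], by linarith [haI.2]⟩ (by
          rw [Real.dist_eq, add_sub_cancel_left, abs_of_pos (by linarith)]; exact hηr)
      have h' := hq _ (hsub (hvI x hx k hk.le))
      rw [Real.dist_eq, abs_le] at h
      rw [← ha, abs_le] at h'
      linarith [h.2, h'.2]
    have h2 : v x (k + 1) - 2 * κ ≤ cdf γ (b - 2 * η) := by
      have h := hunif (b - 2 * η) ⟨by linarith [hbI.1], by linarith [hbI.2]⟩ b
        ⟨by linarith [hbI.1], by linarith [hbI.2]⟩ (by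
          rw [Real.dist_eq, abs_sub_comm, sub_sub_cancel, abs_of_pos (by linarith)]; exact hηr)
      have h' := hq _ (hsub (hvI x hx (k + 1) hk'))
      rw [Real.dist_eq, abs_le] at h
      rw [← hb, abs_le] at h'
      linarith [h.1, h'.1]
    have h3 : v x (k + 1) - v x k = (1 - 2 * κ) * W x k := by
      simp only [v, Finset.sum_range_succ]; ring
    have h4 : W x k ≤ 1 := by
      rw [← hW1 x hx]
      exact Finset.single_le_sum (fun j _ => hW0 x hx j) (Finset.mem_range.2 hk)
    have h5 : cdf γ (b - 2 * η) - cdf γ (a + 2 * η) ≤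
        γ.real (Set.Ioc (a + 2 * η) (b - 2 * η)) := by
      have h := (cdf γ).measure_Ioc (a + 2 * η) (b - 2 * η)
      rw [measure_cdf] at h
      rw [Measure.real, h, ENNReal.toReal_ofReal']
      exact le_max_left _ _
    have h6 : γ.real (Set.Ioc (a + 2 * η) (b - 2 * η)) ≤
        γ.real (Set.Icc (a + 2 * η) (b - 2 * η)) := measureReal_mono Set.Ioc_subset_Icc_self
    nlinarith [hκ, h4]

end Thresholds

/-! ### Neural layers as deterministic functions and as staircases. -/

namespace NeuralLayer

variable {p : ℕ} {σ : ℝ → ℝ} {Y : Set (Fin p → ℝ)}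

/-- Neural layers without hidden units approximate continuous deterministic functions. -/
theorem exists_approx_deterministic (hσ : IsSigmoid σ) (hY : IsCompact Y)
    {h : (Fin p → ℝ) → ℝ} (hh : ContinuousOn h Y) (R : ℝ) {ρ : ℝ} (hρ : 0 < ρ) :
    ∃ L : NeuralLayer p, ∀ c ∈ Y, ∀ e, |e| ≤ R → |L.eval σ c e - h c| ≤ ρ := by
  obtain ⟨M, hM⟩ := MLP.exists_approx hσ hY (k := 1) (f := fun c _ => h c)
    (continuousOn_pi.2 fun _ => hh) (half_pos hρ)
  -- The noise scale must be positive; this value keeps its contribution below `ρ / 2` for `|e| ≤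
  -- R`.
  refine ⟨⟨0, M, .output 0 fun _ => Real.log (ρ / (2 * (|R| + 1))), .output 0 0, .output 0 0,
    .output 0 0⟩, fun c hc e he => ?_⟩
  have hpos : 0 < ρ / (2 * (|R| + 1)) := by positivity
  simp only [NeuralLayer.eval, MLP.eval, Matrix.zero_mulVec, zero_add, Finset.univ_eq_empty,
    Finset.sum_empty, add_zero, Real.exp_log hpos]
  have h1 := hM c hc 0
  have h2 : |ρ / (2 * (|R| + 1)) * e| ≤ ρ / 2 := by
    rw [abs_mul, abs_of_pos hpos]
    calc ρ / (2 * (|R| + 1)) * |e| ≤ ρ / (2 * (|R| + 1)) * (|R| + 1) := by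
          gcongr
          linarith [le_abs_self R]
      _ = ρ / 2 := by field_simp
  rw [add_sub_right_comm]
  exact (abs_add_le _ _).trans (by linarith)

/-- Neural layers approximate staircases with levels `b 0 < ⋯ < b m` that jump at given
continuous functions of the input. -/
theorem exists_approx_staircase (hσ : IsSigmoid σ) (hY : IsCompact Y) {m : ℕ} {b : ℕ → ℝ}
    (hb : ∀ k < m, b k < b (k + 1)) {t : (Fin p → ℝ) → ℕ → ℝ}
    (ht : ∀ k < m, ContinuousOn (fun c => t c k) Y) {η : ℝ} (hη : 0 < η) (R : ℝ) {ρ : ℝ}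
    (hρ : 0 < ρ) :
    ∃ L : NeuralLayer p, ∀ c ∈ Y, ∀ k < m, ∀ e, |e| ≤ R → (∀ l ≤ k, t c l + 2 * η ≤ e) →
      (∀ l, k < l → l < m → e ≤ t c l - 2 * η) → |L.eval σ c e - b (k + 1)| ≤ ρ := by
  set H := b m - b 0 with hH
  have hHsum : ∀ k, ∑ l ∈ Finset.range k, (b (l + 1) - b l) = b k - b 0 := fun k =>
    Finset.sum_range_sub b k
  have hgap : ∀ l : Fin m, 0 < b (l + 1) - b l := fun l => sub_pos.2 (hb l l.isLt)
  have hH0 : 0 ≤ H := by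
    rw [hH, ← hHsum m]
    exact Finset.sum_nonneg fun l hl => (sub_pos.2 (hb l (Finset.mem_range.1 hl))).le
  obtain ⟨B, hB, hB1, hB0⟩ := hσ.exists_forall_close_step
    (show 0 < ρ / (2 * (H + 1)) by positivity)
  -- With slope `B / η`, the margin `2 * η` becomes `2 * B`. The network may waste `B` of it,
  -- leaving the `B` that saturates the sigmoid.
  obtain ⟨M, hM⟩ := MLP.exists_approx hσ hY (k := m) (f := fun c k => -(B / η) * t c k)
    (continuousOn_pi.2 fun k => continuousOn_const.mul (ht k k.isLt)) hB
  refine ⟨⟨m, .output 0 fun _ => b 0, .output 0 fun _ => Real.log (ρ / (2 * (|R| + 1))),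
    .output 0 fun k => Real.log (b (k + 1) - b k), .output 0 fun _ => Real.log (B / η), M⟩,
    fun c hc k hk e he hl hu => ?_⟩
  have hpos : 0 < ρ / (2 * (|R| + 1)) := by positivity
  have hA : 0 < B / η := by positivity
  simp only [NeuralLayer.eval, MLP.eval, Matrix.zero_mulVec, zero_add, Real.exp_log hpos,
    Real.exp_log hA, Real.exp_log (hgap _)]
  have h2 : |ρ / (2 * (|R| + 1)) * e| ≤ ρ / 2 := by
    rw [abs_mul, abs_of_pos hpos]
    calc ρ / (2 * (|R| + 1)) * |e| ≤ ρ / (2 * (|R| + 1)) * (|R| + 1) := by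
          gcongr
          linarith [le_abs_self R]
      _ = ρ / 2 := by field_simp
  have htel : b (k + 1) - b 0 =
      ∑ l : Fin m, (b (l + 1) - b l) * (if (l : ℕ) ≤ k then 1 else 0) := by
    rw [Fin.sum_univ_eq_sum_range (fun l => (b (l + 1) - b l) * (if l ≤ k then 1 else 0)) m,
      ← hHsum]
    simp only [mul_ite, mul_one, mul_zero]
    rw [← Finset.sum_filter]
    congr 1
    ext l
    simp only [Finset.mem_filter, Finset.mem_range]
    omega
  have hterm : ∀ l : Fin m, |(b (l + 1) - b l) * σ (B / η * e + M.eval σ c l) -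
      (b (l + 1) - b l) * (if (l : ℕ) ≤ k then 1 else 0)| ≤
      (b (l + 1) - b l) * (ρ / (2 * (H + 1))) := by
    intro l
    rw [← mul_sub, abs_mul, abs_of_pos (hgap l)]
    refine mul_le_mul_of_nonneg_left ?_ (hgap l).le
    have hσ0 := hσ.pos (B / η * e + M.eval σ c l)
    have hσ1 := hσ.lt_one (B / η * e + M.eval σ c l)
    have hMl := abs_le.1 (hM c hc l)
    have hBη : B / η * (2 * η) = 2 * B := by field_simp
    split_ifs with hlk
    · have h := mul_le_mul_of_nonneg_left (hl l hlk) hA.le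
      rw [mul_add, hBη] at h
      rw [abs_sub_comm, abs_of_pos (by linarith)]
      exact hB1 _ (by linarith [hMl.1])
    · have h := mul_le_mul_of_nonneg_left (hu l (not_le.1 hlk) l.isLt) hA.le
      rw [mul_sub, hBη] at h
      rw [sub_zero, abs_of_pos hσ0]
      exact hB0 _ (by linarith [hMl.2])
  have hsum : |∑ l : Fin m, (b (l + 1) - b l) * σ (B / η * e + M.eval σ c l) -
      (b (k + 1) - b 0)| ≤ ρ / 2 := by
    rw [htel, ← Finset.sum_sub_distrib]
    refine (Finset.abs_sum_le_sum_abs _ _).trans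
      ((Finset.sum_le_sum fun l _ => hterm l).trans ?_)
    rw [← Finset.sum_mul, Fin.sum_univ_eq_sum_range (fun l => b (l + 1) - b l) m, hHsum, ← hH]
    calc H * (ρ / (2 * (H + 1))) ≤ (H + 1) * (ρ / (2 * (H + 1))) := by gcongr; linarith
      _ = ρ / 2 := by field_simp
  have := (abs_add_le _ _).trans (add_le_add h2 hsum)
  refine le_trans (le_of_eq (congrArg _ ?_)) (this.trans_eq (add_halves ρ))
  ring

end NeuralLayer

/-! ### Sampling near finitely many points. -/

instance Density.nullSingletonClass (p : Density ℝ) : NullSingletonClass p.measure := by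
  unfold Density.measure
  infer_instance

theorem exists_measureReal_compl_closedBall_le {N : ℕ} (P : Measure (Fin N → ℝ))
    [IsProbabilityMeasure P] {δ : ℝ} (hδ : 0 < δ) :
    ∃ R, P.real (Metric.closedBall 0 R)ᶜ ≤ δ := by
  obtain ⟨C, hC, hPC⟩ := isTightMeasureSet_iff_exists_isCompact_measure_compl_le.1
    (isTightMeasureSet_singleton (μ := P)) (ENNReal.ofReal δ) (by simpa using hδ)
  obtain ⟨R, hR⟩ := hC.isBounded.subset_closedBall 0
  refine ⟨R, (measureReal_mono (Set.compl_subset_compl.2 hR)).trans ?_⟩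
  exact ENNReal.toReal_le_of_le_ofReal hδ.le (hPC P rfl)

theorem continuous_fin_append {a b : ℕ} :
    Continuous fun v : (Fin a → ℝ) × (Fin b → ℝ) => Fin.append v.1 v.2 := by
  refine continuous_pi fun j => ?_
  refine Fin.addCases (fun i => ?_) (fun i => ?_) j
  · simpa only [Fin.append_left, Function.comp_def] using (continuous_apply i).comp continuous_fst
  · simpa only [Fin.append_right, Function.comp_def] using (continuous_apply i).comp continuous_snd

/-- A continuous function with prescribed values at finitely many points. -/
theorem exists_continuous_interpolation {m : ℕ} {a : ℕ → ℝ}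
    (ha : Set.InjOn a (Finset.range m : Set ℕ)) (r : ℕ → ℝ) :
    ∃ h : ℝ → ℝ, Continuous h ∧ ∀ k < m, h (a k) = r k :=
  ⟨fun u => (Lagrange.interpolate (Finset.range m) a r).eval u, Polynomial.continuous _,
    fun _ hk => Lagrange.eval_interpolate_at_node r ha (Finset.mem_range.2 hk)⟩

theorem lt_of_forall_lt_succ {m : ℕ} {a : ℕ → ℝ} (h : ∀ k, k + 1 < m → a k < a (k + 1))
    {k l : ℕ} (hkl : k < l) (hl : l < m) : a k < a l := by
  induction l, hkl using Nat.le_induction with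
  | base => exact h k hl
  | succ l hkl ih => exact (ih (by omega)).trans (h l hl)

/-- Given finitely many points with increasing first coordinates and weights that depend
continuously on the conditioning inputs, some neural top-down distribution puts at least about
the given weights near the given points, uniformly on a compact set. -/
theorem TopDown.exists_isNeural_near_points {d N : ℕ} (g : Fin N → Density ℝ) {σ : ℝ → ℝ}
    (hσ : IsSigmoid σ) (hN : 0 < N) {K : Set (Fin d → ℝ)} (hK : IsCompact K) {m : ℕ}
    {y : ℕ → Fin N → ℝ} (hy : ∀ k, k + 1 < m → y k ⟨0, hN⟩ < y (k + 1) ⟨0, hN⟩)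
    {W : (Fin d → ℝ) → ℕ → ℝ} (hW : ∀ k, ContinuousOn (fun x => W x k) K)
    (hW0 : ∀ x ∈ K, ∀ k, 0 ≤ W x k) (hW1 : ∀ x ∈ K, ∑ k ∈ Finset.range m, W x k = 1)
    {ρ δ : ℝ} (hρ : 0 < ρ) (hδ : 0 < δ) :
    ∃ T : TopDown d N, T.IsNeural σ ∧ ∀ x ∈ K, ∃ A : ℕ → Set (Fin N → ℝ),
      (∀ k, MeasurableSet (A k)) ∧ (Finset.range m : Set ℕ).PairwiseDisjoint A ∧
      (∀ k < m, W x k - δ ≤ (Measure.pi fun i => (g i).measure).real (A k)) ∧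
      ∀ k < m, ∀ ε ∈ A k, ∀ i, |T.flow x ε i - y k i| ≤ ρ := by
  set P := Measure.pi fun i => (g i).measure with hP
  let i₀ : Fin N := ⟨0, hN⟩
  have hymono : ∀ {k l : ℕ}, k < l → l < m → y k i₀ < y l i₀ :=
    lt_of_forall_lt_succ (a := fun k => y k i₀) hy
  have hinj : Set.InjOn (fun k => y k i₀) (Finset.range m : Set ℕ) := by
    intro k hk l hl hkl
    simp only [Finset.coe_range, Set.mem_Iio] at hk hl
    rcases lt_trichotomy k l with h | h | h
    · exact absurd hkl (hymono h hl).ne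
    · exact h
    · exact absurd hkl (hymono h hk).ne'
  choose h hhc hh using fun i : Fin N => exists_continuous_interpolation hinj fun k => y k i
  -- The first coordinate needs accuracy `ρ₀`, so that the interpolants evaluated at it err by at
  -- most `ρ / 2`.
  obtain ⟨ρ₀, ⟨hρ₀, hρ₀ρ⟩, hρ₀h⟩ : ∃ ρ₀ : ℝ, (0 < ρ₀ ∧ ρ₀ ≤ ρ) ∧ ∀ k ∈ Finset.range m, ∀ i u,
      |u - y k i₀| ≤ ρ₀ → |h i u - y k i| ≤ ρ / 2 := by
    have h1 : ∀ k ∈ Finset.range m, ∀ i, ∀ᶠ r in 𝓝[>] (0 : ℝ), ∀ u,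
        |u - y k i₀| ≤ r → |h i u - y k i| ≤ ρ / 2 := by
      intro k hk i
      obtain ⟨r, hr, hru⟩ := Metric.continuous_iff.1 (hhc i) (y k i₀) (ρ / 2) (half_pos hρ)
      filter_upwards [Ioo_mem_nhdsGT hr] with r' hr' u hu
      have := hru u (by rw [Real.dist_eq]; exact hu.trans_lt hr'.2)
      rw [Real.dist_eq, hh i k (Finset.mem_range.1 hk)] at this
      exact this.le
    have h2 := (eventually_all_finset (Finset.range m)).2 fun k hk => eventually_all.2 (h1 k hk)
    obtain ⟨r, hr, hr'⟩ := (h2.and (Ioc_mem_nhdsGT hρ)).exists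
    exact ⟨r, hr', hr⟩
  -- `B` bounds all latent variables within `ρ` of the points, so that the inputs of later layers
  -- stay in the compact sets `Y i` where the networks are accurate.
  obtain ⟨B, hB⟩ : ∃ B : ℝ, ∀ k ∈ Finset.range m, ∀ i, |y k i| + ρ ≤ B := by
    have h1 : ∀ k ∈ Finset.range m, ∀ᶠ B in atTop, ∀ i, |y k i| + ρ ≤ B := fun k _ =>
      eventually_all.2 fun i => eventually_ge_atTop _
    exact ((eventually_all_finset (Finset.range m)).2 h1).exists
  obtain ⟨R, hR⟩ := exists_measureReal_compl_closedBall_le P (half_pos hδ)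
  obtain ⟨t, η, hη, htc, htmono, htW⟩ := exists_thresholds (g i₀).measure hσ hW hW0 hW1
    (half_pos hδ)
  let Y : (i : Fin N) → Set (Fin (d + i) → ℝ) := fun i =>
    (fun v : (Fin d → ℝ) × (Fin i → ℝ) => Fin.append v.1 v.2) ''
      (K ×ˢ Set.univ.pi fun _ => Set.Icc (-B) B)
  have hY : ∀ i, IsCompact (Y i) := fun i =>
    (hK.prod (isCompact_univ_pi fun _ => isCompact_Icc)).image continuous_fin_append
  -- A dummy level below `y 0 i₀` gives the jump at threshold `0` a positive height; the level after
  -- that jump is `y 0 i₀`.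
  let b : ℕ → ℝ := fun k => Nat.casesOn k (y 0 i₀ - 1) fun k => y k i₀
  have hb : ∀ k < m, b k < b (k + 1) := fun k hk => by
    cases k with
    | zero => exact sub_one_lt _
    | succ k => exact hy k hk
  have hlayer : ∀ i : Fin N, ∃ L : NeuralLayer (d + i),
      (i = i₀ → ∀ c ∈ Y i, ∀ k < m, ∀ e, |e| ≤ R →
        (∀ l ≤ k, t (fun j => c (Fin.castAdd i j)) l + 2 * η ≤ e) →
        (∀ l, k < l → l < m → e ≤ t (fun j => c (Fin.castAdd i j)) l - 2 * η) →
        |L.eval σ c e - y k i₀| ≤ ρ₀) ∧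
      ∀ hi : 0 < i.val, ∀ c ∈ Y i, ∀ e, |e| ≤ R →
        |L.eval σ c e - h i (c (Fin.natAdd d ⟨0, hi⟩))| ≤ ρ / 2 := by
    intro i
    by_cases hi : i = i₀
    · obtain ⟨L, hL⟩ := NeuralLayer.exists_approx_staircase hσ (hY i) hb
        (t := fun c => t fun j => c (Fin.castAdd i j)) (fun k hk => by
          refine (htc k hk.le).comp (Continuous.continuousOn (by fun_prop)) ?_
          rintro _ ⟨v, hv, rfl⟩
          simpa using hv.1) hη R hρ₀
      refine ⟨L, fun _ => hL, fun hi' => ?_⟩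
      rw [hi] at hi'
      exact absurd hi' (lt_irrefl 0)
    · have hi0 : 0 < i.val := Nat.pos_of_ne_zero fun h0 => hi (Fin.ext h0)
      obtain ⟨L, hL⟩ := NeuralLayer.exists_approx_deterministic hσ (hY i)
        (h := fun c => h i (c (Fin.natAdd d ⟨0, hi0⟩)))
        ((hhc i).comp (continuous_apply _)).continuousOn R (half_pos hρ)
      exact ⟨L, fun hi' => absurd hi' hi, fun _ => hL⟩
  choose L hL₀ hL using hlayer
  refine ⟨TopDown.ofNeural hσ L, TopDown.isNeural_ofNeural hσ L, fun x hx =>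
    ⟨fun k => (fun ε => ε i₀) ⁻¹' Set.Icc (t x k + 2 * η) (t x (k + 1) - 2 * η) ∩
      Metric.closedBall 0 R, fun k => ?_, ?_, fun k hk => ?_, fun k hk ε hε => ?_⟩⟩
  · exact (measurable_pi_apply i₀ measurableSet_Icc).inter measurableSet_closedBall
  · have hdisj : ∀ k l, k < l → l < m → ∀ ε : Fin N → ℝ,
        ε i₀ ∈ Set.Icc (t x k + 2 * η) (t x (k + 1) - 2 * η) →
        ε i₀ ∈ Set.Icc (t x l + 2 * η) (t x (l + 1) - 2 * η) → False :=
      fun k l hkl hl ε h1 h2 => by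
        have := htmono x hx (k + 1) l hkl hl.le
        linarith [h1.2, h2.1]
    intro k hk l hl hkl
    simp only [Finset.coe_range, Set.mem_Iio] at hk hl
    refine Set.disjoint_left.2 fun ε h1 h2 => ?_
    rcases lt_or_gt_of_ne hkl with h | h
    · exact hdisj k l h hl ε h1.1 h2.1
    · exact hdisj l k h hk ε h2.1 h1.1
  · have h1 : (g i₀).measure.real (Set.Icc (t x k + 2 * η) (t x (k + 1) - 2 * η)) =
        P.real ((fun ε => ε i₀) ⁻¹' Set.Icc (t x k + 2 * η) (t x (k + 1) - 2 * η)) :=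
      ((measurePreserving_eval (fun i => (g i).measure) i₀).measureReal_preimage
        measurableSet_Icc.nullMeasurableSet).symm
    have h2 := htW x hx k hk
    rw [h1] at h2
    have h3 : P.real ((fun ε => ε i₀) ⁻¹' Set.Icc (t x k + 2 * η) (t x (k + 1) - 2 * η)) ≤
        P.real ((fun ε => ε i₀) ⁻¹' Set.Icc (t x k + 2 * η) (t x (k + 1) - 2 * η) ∩
          Metric.closedBall 0 R) + P.real (Metric.closedBall 0 R)ᶜ := by
      refine (measureReal_mono fun ε hε => ?_).trans (measureReal_union_le _ _)
      by_cases hεR : ε ∈ Metric.closedBall 0 R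
      · exact Or.inl ⟨hε, hεR⟩
      · exact Or.inr hεR
    linarith
  · set T := TopDown.ofNeural hσ L
    have hεR : ∀ i, |ε i| ≤ R := fun i =>
      (norm_le_pi_norm ε i).trans (mem_closedBall_zero_iff.1 hε.2)
    have hkm := Finset.mem_range.2 hk
    have hctx : ∀ i : Fin N, (∀ j < i, |T.flow x ε j - y k j| ≤ ρ) →
        context x (T.flow x ε) i ∈ Y i := fun i hj => by
      refine ⟨(x, fun j : Fin i => T.flow x ε ⟨j, j.isLt.trans i.isLt⟩), ⟨hx, fun j _ => ?_⟩, rfl⟩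
      have h1 := hj ⟨j, j.isLt.trans i.isLt⟩ j.isLt
      have h2 := hB k hkm ⟨j, j.isLt.trans i.isLt⟩
      have h3 := abs_le.1 h1
      have h4 := abs_le.1 (show |y k ⟨j, j.isLt.trans i.isLt⟩| ≤ B - ρ by linarith)
      exact ⟨by linarith [h3.1, h4.1], by linarith [h3.2, h4.2]⟩
    have h0 : |T.flow x ε i₀ - y k i₀| ≤ ρ₀ := by
      rw [flow_apply]
      have hx' : (fun j => context x (T.flow x ε) i₀ (Fin.castAdd i₀ j)) = x := by
        funext j
        exact Fin.append_left _ _ j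
      refine hL₀ i₀ rfl _ (hctx i₀ fun j hj => absurd hj (Nat.not_lt_zero _)) k hk _ (hεR i₀)
        (fun l hl => ?_) fun l hkl hl => ?_
      · rw [hx']
        linarith [htmono x hx l k hl hk.le, hε.1.1]
      · rw [hx']
        linarith [htmono x hx (k + 1) l hkl hl.le, hε.1.2]
    intro i
    induction i using WellFoundedLT.induction with
    | ind i ih =>
      by_cases hi : i = i₀
      · rw [hi]
        exact h0.trans hρ₀ρ
      · have hi0 : 0 < i.val := Nat.pos_of_ne_zero fun h0 => hi (Fin.ext h0)
        rw [flow_apply]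
        have h1 := hL i hi0 _ (hctx i ih) (ε i) (hεR i)
        have h2 : context x (T.flow x ε) i (Fin.natAdd d ⟨0, hi0⟩) = T.flow x ε i₀ :=
          Fin.append_right _ _ _
        rw [h2] at h1
        have h3 := hρ₀h k hkm i _ h0
        calc _ ≤ _ := abs_sub_le _ (h i (T.flow x ε i₀)) _
          _ ≤ ρ / 2 + ρ / 2 := add_le_add h1 h3
          _ = ρ := add_halves ρ

/-! ### Simultaneous continuity on large compact sets. -/

section Lusin

/-- **Lusin's theorem** for countably many functions: measurable functions are simultaneously
continuous on a compact set of almost full measure. -/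
theorem exists_isCompact_forall_continuousOn {D : ℕ} (μ : Measure (Fin D → ℝ))
    [IsProbabilityMeasure μ] {w : ℕ → (Fin D → ℝ) → ℝ} (hw : ∀ k, Measurable (w k))
    {δ : ENNReal} (hδ : δ ≠ 0) :
    ∃ K, IsCompact K ∧ μ Kᶜ ≤ δ ∧ ∀ k, ContinuousOn (w k) K := by
  let B := TopologicalSpace.countableBasis ℝ
  have : Countable B := (TopologicalSpace.countable_countableBasis ℝ).to_subtype
  let S : ℕ × B → Set (Fin D → ℝ) := fun i => w i.1 ⁻¹' i.2
  have hS : ∀ i, MeasurableSet (S i) := fun i =>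
    hw i.1 (TopologicalSpace.isOpen_of_mem_countableBasis i.2.2).measurableSet
  have hδ2 : δ / 2 ≠ 0 := (ENNReal.half_pos hδ).ne'
  obtain ⟨ε, hε, hεsum⟩ := ENNReal.exists_pos_sum_of_countable' hδ2 (ℕ × B)
  obtain ⟨C, hC, hμC⟩ := isTightMeasureSet_iff_exists_isCompact_measure_compl_le.1
    (isTightMeasureSet_singleton (μ := μ)) (δ / 2) (ENNReal.half_pos hδ)
  -- Both the preimage of each basic open set and its complement are approximated from inside by
  -- closed sets. On their union the preimage is relatively open; the total loss is summable over
  -- the countable index.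
  choose F hFS hFc hF using fun i => (hS i).exists_isClosed_sdiff_lt (measure_ne_top μ _)
    (ENNReal.half_pos (hε i).ne').ne'
  choose F' hFS' hFc' hF' using fun i => (hS i).compl.exists_isClosed_sdiff_lt
    (measure_ne_top μ _) (ENNReal.half_pos (hε i).ne').ne'
  refine ⟨C ∩ ⋂ i, (F i ∪ F' i),
    hC.inter_right (isClosed_iInter fun i => (hFc i).union (hFc' i)), ?_, fun k => ?_⟩
  · have hcover : ∀ i, μ (F i ∪ F' i)ᶜ ≤ ε i := fun i => by
      have hsub : (F i ∪ F' i)ᶜ ⊆ (S i \ F i) ∪ ((S i)ᶜ \ F' i) := fun x hx => by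
        rw [Set.mem_compl_iff, Set.mem_union, not_or] at hx
        by_cases hxS : x ∈ S i
        · exact Or.inl ⟨hxS, hx.1⟩
        · exact Or.inr ⟨hxS, hx.2⟩
      calc μ (F i ∪ F' i)ᶜ ≤ μ (S i \ F i) + μ ((S i)ᶜ \ F' i) :=
            (measure_mono hsub).trans (measure_union_le _ _)
        _ ≤ ε i / 2 + ε i / 2 := add_le_add (hF i).le (hF' i).le
        _ = ε i := ENNReal.add_halves _
    rw [Set.compl_inter, Set.compl_iInter]
    calc _ ≤ μ Cᶜ + μ (⋃ i, (F i ∪ F' i)ᶜ) := measure_union_le _ _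
      _ ≤ δ / 2 + δ / 2 := add_le_add (hμC μ rfl)
          ((measure_iUnion_le _).trans ((ENNReal.tsum_le_tsum hcover).trans hεsum.le))
      _ = δ := ENNReal.add_halves _
  · rw [continuousOn_iff_continuous_domRestrict,
      (TopologicalSpace.isBasis_countableBasis ℝ).continuous_iff]
    intro U hU
    have heq : (C ∩ ⋂ i, (F i ∪ F' i)).domRestrict (w k) ⁻¹' U =
        Subtype.val ⁻¹' (F' (k, ⟨U, hU⟩))ᶜ := by
      ext ⟨x, hx⟩
      have hx' := Set.mem_iInter.1 hx.2 (k, ⟨U, hU⟩)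
      constructor
      · intro h1 h2
        exact hFS' _ h2 h1
      · intro h1
        exact hFS _ (hx'.resolve_right h1)
    rw [heq]
    exact (hFc' _).isOpen_compl.preimage continuous_subtype_val

end Lusin

/-! ### Discrete approximation of measures, tested on bounded Lipschitz functions. -/

section Approximation

variable {E : Type*} [PseudoMetricSpace E]

/-- The partition of unity given by the soft minimum of the distances to the points
`y 0, …, y n`. -/
def softMin (β : ℝ) (n : ℕ) (y : ℕ → E) (k : ℕ) (z : E) : ℝ :=
  Real.exp (-β * dist z (y k)) / ∑ l ∈ Finset.range (n + 1), Real.exp (-β * dist z (y l))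

variable (β : ℝ) (n : ℕ) (y : ℕ → E)

theorem softMin_denom_pos (z : E) :
    0 < ∑ l ∈ Finset.range (n + 1), Real.exp (-β * dist z (y l)) :=
  Finset.sum_pos (fun _ _ => Real.exp_pos _) ⟨0, by simp⟩

theorem softMin_nonneg (k : ℕ) (z : E) : 0 ≤ softMin β n y k z :=
  div_nonneg (Real.exp_pos _).le (softMin_denom_pos β n y z).le

theorem sum_softMin (z : E) : ∑ k ∈ Finset.range (n + 1), softMin β n y k z = 1 := by
  unfold softMin
  rw [← Finset.sum_div, div_self (softMin_denom_pos β n y z).ne']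

theorem continuous_softMin (k : ℕ) : Continuous (softMin β n y k) := by
  unfold softMin
  refine Continuous.div ?_ ?_ fun z => (softMin_denom_pos β n y z).ne' <;> fun_prop

/-- A point farther than `y k₀` by `u > 0` has weight at most `exp (-β u)`, and `β u * exp (-β u) ≤
1`. -/
theorem softMin_mul_dist_sub_le {β : ℝ} (hβ : 0 < β) (k : ℕ) {k₀ : ℕ}
    (hk₀ : k₀ ∈ Finset.range (n + 1)) (z : E) : softMin β n y k z * (dist z (y k) - dist z (y k₀)) ≤ 1 / β := by
  set u := dist z (y k) - dist z (y k₀) with hu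
  rcases le_or_gt u 0 with h | h
  · exact (mul_nonpos_of_nonneg_of_nonpos (softMin_nonneg β n y k z) h).trans (by positivity)
  · have h1 : softMin β n y k z ≤ Real.exp (-(β * u)) := by
      have h2 : Real.exp (-β * dist z (y k₀)) ≤
          ∑ l ∈ Finset.range (n + 1), Real.exp (-β * dist z (y l)) :=
        Finset.single_le_sum (f := fun l => Real.exp (-β * dist z (y l)))
          (fun l _ => (Real.exp_pos _).le) hk₀
      rw [softMin, div_le_iff₀ (softMin_denom_pos β n y z)]
      refine le_trans (le_of_eq ?_) (mul_le_mul_of_nonneg_left h2 (Real.exp_pos _).le)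
      rw [← Real.exp_add]
      congr 1
      rw [hu]
      ring
    have h2 : Real.exp (-(β * u)) * (β * u) ≤ 1 := by
      rw [Real.exp_neg, inv_mul_le_iff₀ (Real.exp_pos _), mul_one]
      linarith [Real.add_one_le_exp (β * u)]
    calc softMin β n y k z * u ≤ Real.exp (-(β * u)) * u := by gcongr
      _ = Real.exp (-(β * u)) * (β * u) / β := by field_simp
      _ ≤ 1 / β := by gcongr

/-- The weighted mean distance from `z` to the points exceeds the distance to `y k₀` by at most `1 /
β` per point. -/
theorem abs_sum_softMin_mul_sub_le {β : ℝ} (hβ : 0 < β) {L : NNReal} {f : E → ℝ}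
    (hf : LipschitzWith L f) {k₀ : ℕ} (hk₀ : k₀ ∈ Finset.range (n + 1)) (z : E) :
    |∑ k ∈ Finset.range (n + 1), softMin β n y k z * f (y k) - f z| ≤
      L * (dist z (y k₀) + (n + 1) / β) := by
  have h1 : ∑ k ∈ Finset.range (n + 1), softMin β n y k z * f (y k) - f z =
      ∑ k ∈ Finset.range (n + 1), softMin β n y k z * (f (y k) - f z) := by
    simp only [mul_sub, Finset.sum_sub_distrib, ← Finset.sum_mul, sum_softMin, one_mul]
  have h2 : ∀ k ∈ Finset.range (n + 1), |softMin β n y k z * (f (y k) - f z)| ≤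
      L * (softMin β n y k z * dist z (y k₀) + 1 / β) := fun k _ => by
    rw [abs_mul, abs_of_nonneg (softMin_nonneg β n y k z)]
    have h3 : |f (y k) - f z| ≤ L * dist z (y k) := by
      rw [dist_comm z, ← Real.dist_eq]
      exact hf.dist_le_mul _ _
    have h4 := softMin_mul_dist_sub_le n y hβ k hk₀ z
    calc _ ≤ softMin β n y k z * (L * dist z (y k)) :=
          mul_le_mul_of_nonneg_left h3 (softMin_nonneg β n y k z)
      _ = L * (softMin β n y k z * dist z (y k)) := by ring
      _ ≤ _ := by
        refine mul_le_mul_of_nonneg_left ?_ L.coe_nonneg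
        linarith
  rw [h1]
  refine (Finset.abs_sum_le_sum_abs _ _).trans ((Finset.sum_le_sum h2).trans (le_of_eq ?_))
  rw [← Finset.mul_sum, Finset.sum_add_distrib, ← Finset.sum_mul, sum_softMin]
  simp [div_eq_mul_inv]

variable {Ω : Type*} [MeasurableSpace Ω] [MeasurableSpace E] [OpensMeasurableSpace E]

/-- A random variable that takes values near `y k` with probability at least about `W k`, where
`∑ k, W k = 1`, is approximately distributed as `∑ k, W k • δ (y k)`: lower bound. -/
theorem le_integral_comp_of_near_points {P : Measure Ω} [IsProbabilityMeasure P] {F : Ω → E}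
    (hF : Measurable F) {m : ℕ} {y : ℕ → E} {W : ℕ → ℝ} {A : ℕ → Set Ω} {ρ δ : ℝ}
    (hρ : 0 ≤ ρ) (hW : ∑ k ∈ Finset.range m, W k = 1) (hA : ∀ k, MeasurableSet (A k))
    (hdisj : (Finset.range m : Set ℕ).PairwiseDisjoint A) (hPA : ∀ k < m, W k - δ ≤ P.real (A k))
    (hFA : ∀ k < m, ∀ ω ∈ A k, dist (F ω) (y k) ≤ ρ) (hδ : 0 ≤ δ) {f : E → ℝ} {L : NNReal}
    (hf : LipschitzWith L f) {C : ℝ} (hC : ∀ z, |f z| ≤ C) :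
    ∑ k ∈ Finset.range m, W k * f (y k) - (2 * m * δ * C + L * ρ) ≤ ∫ ω, f (F ω) ∂P := by
  have hmeas : AEStronglyMeasurable (fun ω => f (F ω)) P :=
    (hf.continuous.measurable.comp hF).aestronglyMeasurable
  have hint : Integrable (fun ω => f (F ω)) P :=
    Integrable.of_bound hmeas C (Eventually.of_forall fun ω => hC _)
  -- Shifting by `C` makes the integrand nonnegative, so the part outside the sets `A k` can be
  -- dropped and lower bounds on their probabilities suffice.
  have hint' : Integrable (fun ω => f (F ω) + C) P := hint.add (integrable_const C)
  have hnn : ∀ z, 0 ≤ f z + C := fun z => by linarith [(abs_le.1 (hC z)).1]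
  have hfC : ∀ z, f z + C ≤ 2 * C := fun z => by linarith [(abs_le.1 (hC z)).2]
  have h1 : ∑ k ∈ Finset.range m, ∫ ω in A k, (f (F ω) + C) ∂P ≤ ∫ ω, (f (F ω) + C) ∂P := by
    rw [← integral_biUnion_finset _ (fun k _ => hA k) hdisj fun k _ => hint'.integrableOn]
    exact setIntegral_le_integral hint' (Eventually.of_forall fun ω => hnn _)
  have h2 : ∀ k ∈ Finset.range m,
      W k * (f (y k) + C) - 2 * δ * C - L * ρ * P.real (A k) ≤
        ∫ ω in A k, (f (F ω) + C) ∂P := fun k hk => by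
    have hk' := Finset.mem_range.1 hk
    have h3 : ∫ _ω in A k, (f (y k) + C - L * ρ) ∂P ≤ ∫ ω in A k, (f (F ω) + C) ∂P := by
      refine setIntegral_mono_on (integrable_const _).integrableOn hint'.integrableOn (hA k)
        fun ω hω => ?_
      have h4 := hf.dist_le_mul (F ω) (y k)
      have h5 : (L : ℝ) * dist (F ω) (y k) ≤ L * ρ :=
        mul_le_mul_of_nonneg_left (hFA k hk' ω hω) L.coe_nonneg
      rw [Real.dist_eq] at h4
      linarith [(abs_le.1 (h4.trans h5)).1]
    rw [setIntegral_const, smul_eq_mul] at h3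
    have h6 := mul_le_mul_of_nonneg_right (hPA k hk') (hnn (y k))
    have h7 := mul_le_mul_of_nonneg_left (hfC (y k)) hδ
    nlinarith
  have h3 : ∑ k ∈ Finset.range m, P.real (A k) ≤ 1 := by
    rw [← measureReal_biUnion_finset hdisj fun k _ => hA k]
    exact measureReal_le_one
  have h4 := (Finset.sum_le_sum h2).trans h1
  rw [integral_add hint (integrable_const C)] at h4
  simp only [mul_add, Finset.sum_sub_distrib, Finset.sum_add_distrib, ← Finset.sum_mul,
    ← Finset.mul_sum, hW, Finset.sum_const, Finset.card_range, nsmul_eq_mul, integral_const,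
    probReal_univ, smul_eq_mul, one_mul] at h4
  have h5 := mul_le_mul_of_nonneg_left h3 (mul_nonneg L.coe_nonneg hρ)
  linarith

/-- The lower bound applied to `f` and to `-f`. -/
theorem abs_integral_comp_sub_le_of_near_points {P : Measure Ω} [IsProbabilityMeasure P]
    {F : Ω → E} (hF : Measurable F) {m : ℕ} {y : ℕ → E} {W : ℕ → ℝ} {A : ℕ → Set Ω} {ρ δ : ℝ}
    (hρ : 0 ≤ ρ) (hW : ∑ k ∈ Finset.range m, W k = 1) (hA : ∀ k, MeasurableSet (A k))
    (hdisj : (Finset.range m : Set ℕ).PairwiseDisjoint A) (hPA : ∀ k < m, W k - δ ≤ P.real (A k))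
    (hFA : ∀ k < m, ∀ ω ∈ A k, dist (F ω) (y k) ≤ ρ) (hδ : 0 ≤ δ) {f : E → ℝ} {L : NNReal}
    (hf : LipschitzWith L f) {C : ℝ} (hC : ∀ z, |f z| ≤ C) :
    |∫ ω, f (F ω) ∂P - ∑ k ∈ Finset.range m, W k * f (y k)| ≤ 2 * m * δ * C + L * ρ := by
  have h1 := le_integral_comp_of_near_points hF hρ hW hA hdisj hPA hFA hδ hf hC
  have h2 := le_integral_comp_of_near_points hF hρ hW hA hdisj hPA hFA hδ hf.neg
    (C := C) fun z => by simpa using hC z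
  simp only [Pi.neg_apply, mul_neg, Finset.sum_neg_distrib, integral_neg] at h2
  rw [abs_le]
  constructor <;> linarith

end Approximation

/-- Points with increasing first coordinates near finitely many given points. -/
theorem exists_increasing_points {N : ℕ} (hN : 0 < N) (d : ℕ → Fin N → ℝ) (n : ℕ) :
    ∃ y : ℕ → Fin N → ℝ, (∀ k, k + 1 < n + 1 → y k ⟨0, hN⟩ < y (k + 1) ⟨0, hN⟩) ∧
      ∀ k < n + 1, ∃ l < n + 1, dist (d k) (y l) ≤ 1 / (n + 1) := by
  let i₀ : Fin N := ⟨0, hN⟩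
  -- Adding `s * k` to the `k`-th first coordinate creates a tie only for countably many slopes `s`.
  -- Once ties are excluded, sorting gives the increasing order.
  obtain ⟨s, hs, hs0, hs1⟩ : ∃ s ∈ (Set.range fun v : ℕ × ℕ =>
      (d v.1 i₀ - d v.2 i₀) / ((v.2 : ℝ) - v.1))ᶜ, 0 < s ∧ s < 1 / ((n : ℝ) + 1) ^ 2 :=
    ((Set.countable_range _).dense_compl ℝ).exists_between (by positivity)
  let u : ℕ → Fin N → ℝ := fun k => d k + Pi.single i₀ (s * k)
  have hu : ∀ k l, u k i₀ = u l i₀ → k = l := fun k l hkl => by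
    by_contra hne
    have hne' : (l : ℝ) - k ≠ 0 := sub_ne_zero.2 fun h => hne (Nat.cast_injective h).symm
    refine hs ⟨(k, l), ?_⟩
    simp only [u, Pi.add_apply, Pi.single_eq_same] at hkl
    simp only
    rw [div_eq_iff hne']
    linarith
  have hud : ∀ k < n + 1, dist (d k) (u k) ≤ 1 / (n + 1) := fun k hk => by
    have hk' : (k : ℝ) ≤ n + 1 := by exact_mod_cast hk.le
    have h1 : s * k ≤ 1 / ((n : ℝ) + 1) ^ 2 * (n + 1) := by gcongr
    have h2 : 1 / ((n : ℝ) + 1) ^ 2 * (n + 1) = 1 / (n + 1) := by field_simp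
    rw [dist_self_add_right, Pi.norm_single, Real.norm_eq_abs, abs_of_nonneg (by positivity)]
    exact h1.trans h2.le
  let a : Fin (n + 1) → ℝ := fun k => u k i₀
  let π := Tuple.sort a
  have hmono : StrictMono (a ∘ π) :=
    (Tuple.monotone_sort a).strictMono_of_injective fun k l hkl =>
      π.injective (Fin.ext (hu _ _ hkl))
  refine ⟨fun k => if h : k < n + 1 then u (π ⟨k, h⟩) else 0, fun k hk => ?_, fun k hk => ?_⟩
  · simp only [dif_pos hk, dif_pos ((Nat.lt_succ_self k).trans hk)]
    exact hmono (Fin.mk_lt_mk.2 (Nat.lt_succ_self k))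
  · refine ⟨π.symm ⟨k, hk⟩, (π.symm ⟨k, hk⟩).isLt, ?_⟩
    simp only [dif_pos (π.symm ⟨k, hk⟩).isLt, Fin.eta, Equiv.apply_symm_apply]
    exact hud k hk

/-! ### Convergence of neural top-down distributions. -/

section Universality

variable {D N : ℕ}

theorem measurable_integral_density (q : (Fin D → ℝ) → Density (Fin N → ℝ))
    (hq : Measurable fun v : (Fin D → ℝ) × (Fin N → ℝ) => (q v.1).pdf v.2)
    {φ : (Fin N → ℝ) → ℝ} (hφ : Continuous φ) :
    Measurable fun x => ∫ z, φ z ∂(q x).measure := by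
  have h : ∀ x, ∫ z, φ z ∂(q x).measure = ∫ z, (q x).pdf z * φ z := fun x => by
    rw [Density.measure, integral_withDensity_eq_integral_toReal_smul
      (q x).measurable_pdf.ennreal_ofReal (Eventually.of_forall fun _ => ENNReal.ofReal_lt_top)]
    refine integral_congr_ae (Eventually.of_forall fun z => ?_)
    simp only [ENNReal.toReal_ofReal ((q x).nonneg z), smul_eq_mul]
  simp only [h]
  exact (StronglyMeasurable.integral_prod_right
    (hq.mul (hφ.measurable.comp measurable_snd)).stronglyMeasurable).measurable

/-- Compact sets that exhaust the data space, almost everywhere or everywhere, on which the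
weights are continuous. -/
theorem exists_compact_exhaustion (q : (Fin D → ℝ) → Density (Fin N → ℝ))
    (hq : Measurable fun v : (Fin D → ℝ) × (Fin N → ℝ) => (q v.1).pdf v.2)
    (μ : Measure (Fin D → ℝ)) [IsProbabilityMeasure μ] {φ : ℕ → ℕ → (Fin N → ℝ) → ℝ}
    (hφ : ∀ n k, Continuous (φ n k)) {C : ℝ} (hC : ∀ n k z, |φ n k z| ≤ C) :
    ∃ K : ℕ → Set (Fin D → ℝ), (∀ n, IsCompact (K n)) ∧
      (∀ n k, ContinuousOn (fun x => ∫ z, φ n k z ∂(q x).measure) (K n)) ∧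
      (∀ᵐ x ∂μ, ∀ᶠ n in atTop, x ∈ K n) ∧
      (Continuous (fun x => (q x).law) → ∀ x, ∀ᶠ n in atTop, x ∈ K n) := by
  -- The case distinction lets one exhaustion serve both conclusions: balls for continuous `q`,
  -- otherwise Lusin sets with summable complements and Borel–Cantelli.
  by_cases hcont : Continuous fun x => (q x).law
  · have hev : ∀ x : Fin D → ℝ, ∀ᶠ n : ℕ in atTop, x ∈ Metric.closedBall 0 (n : ℝ) := fun x => by
      filter_upwards [eventually_ge_atTop ⌈‖x‖⌉₊] with n hn
      exact mem_closedBall_zero_iff.2 (Nat.ceil_le.1 hn)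
    refine ⟨fun n => Metric.closedBall 0 n, fun n => isCompact_closedBall _ _, fun n k => ?_,
      Eventually.of_forall hev, fun _ => hev⟩
    exact (ProbabilityMeasure.continuous_iff_forall_continuous_integral.1 hcont
      (BoundedContinuousFunction.ofNormedAddCommGroup (φ n k) (hφ n k) C (hC n k))).continuousOn
  · choose K hK hμK hcK using fun n : ℕ => exists_isCompact_forall_continuousOn μ
      (fun k => measurable_integral_density q hq (hφ n k))
      (δ := (2⁻¹ : ENNReal) ^ n) (by simp)
    refine ⟨K, hK, hcK, ?_, fun h => absurd h hcont⟩
    have hsum : ∑' n, μ (K n)ᶜ ≠ ⊤ := by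
      refine ne_top_of_le_ne_top ?_ (ENNReal.tsum_le_tsum hμK)
      rw [ENNReal.tsum_geometric, ENNReal.one_sub_inv_two, inv_inv]
      exact ENNReal.ofNat_ne_top
    filter_upwards [ae_eventually_notMem hsum] with x hx
    exact hx.mono fun n hn => not_not.1 hn

theorem tendsto_const_mul_one_div_succ (C : ℝ) :
    Tendsto (fun n : ℕ => C * (1 / ((n : ℝ) + 1))) atTop (𝓝 0) := by
  simpa using tendsto_one_div_add_atTop_nhds_zero_nat.const_mul C

theorem TopDown.exists_isNeural_tendsto (g : Fin N → Density ℝ) {σ : ℝ → ℝ} (hσ : IsSigmoid σ)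
    (q : (Fin D → ℝ) → Density (Fin N → ℝ))
    (hq : Measurable fun v : (Fin D → ℝ) × (Fin N → ℝ) => (q v.1).pdf v.2)
    (μ : Measure (Fin D → ℝ)) [IsProbabilityMeasure μ] :
    ∃ T : ℕ → TopDown D N, (∀ n, (T n).IsNeural σ) ∧
      (∀ᵐ x ∂μ, Tendsto (fun n => (T n).law g x) atTop (𝓝 (q x).law)) ∧
      (Continuous (fun x => (q x).law) →
        ∀ x, Tendsto (fun n => (T n).law g x) atTop (𝓝 (q x).law)) := by
  rcases Nat.eq_zero_or_pos N with rfl | hN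
  · have hsub : ∀ P Q : ProbabilityMeasure (Fin 0 → ℝ), P = Q := fun P Q => by
      refine Subtype.ext (Measure.ext fun s _ => ?_)
      rcases Set.eq_empty_or_nonempty s with rfl | hs
      · simp
      · rw [Set.Nonempty.eq_univ hs]
        exact P.2.measure_univ.trans Q.2.measure_univ.symm
    have htend : ∀ (T : TopDown D 0) x,
        Tendsto (fun _ : ℕ => T.law g x) atTop (𝓝 (q x).law) := fun T x => by
      rw [hsub (T.law g x) (q x).law]
      exact tendsto_const_nhds
    exact ⟨fun _ => ofNeural hσ fun i => i.elim0, fun _ => isNeural_ofNeural hσ _,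
      Eventually.of_forall fun x => htend _ x, fun _ x => htend _ x⟩
  let P := Measure.pi fun i => (g i).measure
  let d : ℕ → Fin N → ℝ := TopologicalSpace.denseSeq _
  choose y hymono hyd using exists_increasing_points hN d
  -- This growth makes the soft minimum error `(n + 1) / β n` equal to `1 / (n + 1)`.
  let β : ℕ → ℝ := fun n => ((n : ℝ) + 1) ^ 2
  have hβ : ∀ n, 0 < β n := fun n => by positivity
  -- Set to zero beyond index `n`, where `softMin` is not part of the partition and need not be
  -- bounded by `1`.
  let φ : ℕ → ℕ → (Fin N → ℝ) → ℝ := fun n k z =>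
    if k < n + 1 then softMin (β n) n (y n) k z else 0
  have hφc : ∀ n k, Continuous (φ n k) := fun n k => by
    by_cases hk : k < n + 1
    · simpa only [φ, if_pos hk] using continuous_softMin _ _ _ _
    · simpa only [φ, if_neg hk] using continuous_const
  have hφ0 : ∀ n k z, 0 ≤ φ n k z := fun n k z => by
    simp only [φ]
    split_ifs
    · exact softMin_nonneg _ _ _ _ _
    · exact le_rfl
  have hφsum : ∀ n (f : ℕ → ℝ) z, ∑ k ∈ Finset.range (n + 1), φ n k z * f k =
      ∑ k ∈ Finset.range (n + 1), softMin (β n) n (y n) k z * f k := fun n f z =>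
    Finset.sum_congr rfl fun k hk => by simp only [φ, if_pos (Finset.mem_range.1 hk)]
  have hφ1 : ∀ n z, ∑ k ∈ Finset.range (n + 1), φ n k z = 1 := fun n z => by
    simpa only [mul_one, sum_softMin] using hφsum n (fun _ => 1) z
  have hφle : ∀ n k z, |φ n k z| ≤ 1 := fun n k z => by
    rw [abs_of_nonneg (hφ0 n k z)]
    by_cases hk : k < n + 1
    · rw [← hφ1 n z]
      exact Finset.single_le_sum (fun l _ => hφ0 n l z) (Finset.mem_range.2 hk)
    · simp only [φ, if_neg hk, zero_le_one]
  have hφint : ∀ n k x, Integrable (φ n k) (q x).measure := fun n k x =>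
    Integrable.of_bound (hφc n k).aestronglyMeasurable 1 (Eventually.of_forall (hφle n k))
  obtain ⟨K, hK, hWc, hKae, hKall⟩ := exists_compact_exhaustion q hq μ hφc hφle
  let W : ℕ → (Fin D → ℝ) → ℕ → ℝ := fun n x k => ∫ z, φ n k z ∂(q x).measure
  have hW0 : ∀ n x k, 0 ≤ W n x k := fun n x k => integral_nonneg (hφ0 n k)
  have hW1 : ∀ n x, ∑ k ∈ Finset.range (n + 1), W n x k = 1 := fun n x => by
    simp only [W]
    rw [← integral_finsetSum _ fun k _ => hφint n k x]
    simp [hφ1]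
  -- With `n + 1` points, the loss `1 / (n + 1) ^ 2` per point adds up to `1 / (n + 1)`.
  choose T hT hTA using fun n : ℕ => exists_isNeural_near_points g hσ hN (hK n) (hymono n) (hWc n)
    (fun x _ k => hW0 n x k) (fun x _ => hW1 n x) (ρ := 1 / ((n : ℝ) + 1))
    (δ := 1 / ((n : ℝ) + 1) ^ 2) (by positivity) (by positivity)
  have hmain : ∀ x, (∀ᶠ n in atTop, x ∈ K n) →
      Tendsto (fun n => (T n).law g x) atTop (𝓝 (q x).law) := by
    intro x hx
    rw [tendsto_iff_forall_lipschitz_integral_tendsto]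
    rintro f ⟨C₀, hC₀⟩ ⟨L, hL⟩
    obtain ⟨C, hC⟩ : ∃ C, ∀ z, |f z| ≤ C := ⟨C₀ + |f 0|, fun z => by
      have h1 := hC₀ z 0
      rw [Real.dist_eq] at h1
      have h2 := abs_add_le (f z - f 0) (f 0)
      rw [sub_add_cancel] at h2
      linarith⟩
    have hsoft : ∀ z, Tendsto (fun n => ∑ k ∈ Finset.range (n + 1), φ n k z * f (y n k)) atTop
        (𝓝 (f z)) := by
      intro z
      rw [Metric.tendsto_atTop']
      intro ε hε
      obtain ⟨k₀, hk₀⟩ := (TopologicalSpace.denseRange_denseSeq (Fin N → ℝ)).exists_dist_lt z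
        (show 0 < ε / (2 * (L + 1)) by positivity)
      obtain ⟨n₀, hn₀⟩ := eventually_atTop.1
        ((tendsto_const_mul_one_div_succ (2 * L)).eventually (gt_mem_nhds (half_pos hε)))
      refine ⟨max k₀ n₀, fun n hn => ?_⟩
      obtain ⟨l, hl, hdl⟩ := hyd n k₀ (by omega)
      have h1 := abs_sum_softMin_mul_sub_le n (y n) (hβ n) hL (Finset.mem_range.2 hl) z
      have h2 := hn₀ n (by omega)
      have h3 : ((n : ℝ) + 1) / β n = 1 / (n + 1) := by simp only [β]; field_simp
      have h4 : dist z (y n l) ≤ ε / (2 * (L + 1)) + 1 / (n + 1) :=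
        (dist_triangle _ _ _).trans (add_le_add hk₀.le hdl)
      rw [Real.dist_eq, hφsum n fun k => f (y n k)]
      rw [h3] at h1
      have h5 := mul_le_mul_of_nonneg_left h4 L.coe_nonneg
      have h6 : (L : ℝ) * (ε / (2 * (L + 1))) ≤ ε / 2 := by
        calc (L : ℝ) * (ε / (2 * (L + 1))) ≤ (L + 1) * (ε / (2 * (L + 1))) := by
              gcongr; linarith
          _ = ε / 2 := by field_simp
      linarith
    have hlim : Tendsto (fun n => ∑ k ∈ Finset.range (n + 1), W n x k * f (y n k)) atTop
        (𝓝 (∫ z, f z ∂(q x).measure)) := by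
      have heq : ∀ n, ∑ k ∈ Finset.range (n + 1), W n x k * f (y n k) =
          ∫ z, ∑ k ∈ Finset.range (n + 1), φ n k z * f (y n k) ∂(q x).measure := fun n => by
        rw [integral_finsetSum _ fun k _ => (hφint n k x).mul_const _]
        exact Finset.sum_congr rfl fun k _ => (integral_mul_const _ _).symm
      simp only [heq]
      refine tendsto_integral_of_dominated_convergence (fun _ => C) (fun n => ?_)
        (integrable_const C) (fun n => Eventually.of_forall fun z => ?_)
        (Eventually.of_forall hsoft)
      · exact (continuous_finsetSum _ fun k _ =>
          (hφc n k).mul continuous_const).aestronglyMeasurable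
      · calc ‖∑ k ∈ Finset.range (n + 1), φ n k z * f (y n k)‖
            ≤ ∑ k ∈ Finset.range (n + 1), ‖φ n k z * f (y n k)‖ := norm_sum_le _ _
          _ ≤ ∑ k ∈ Finset.range (n + 1), φ n k z * C := by
            refine Finset.sum_le_sum fun k _ => ?_
            rw [norm_mul, Real.norm_eq_abs, abs_of_nonneg (hφ0 n k z)]
            exact mul_le_mul_of_nonneg_left (hC _) (hφ0 n k z)
          _ = C := by rw [← Finset.sum_mul, hφ1, one_mul]
    have hclose : Tendsto (fun n => ∫ z, f z ∂((T n).law g x : Measure (Fin N → ℝ)) -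
        ∑ k ∈ Finset.range (n + 1), W n x k * f (y n k)) atTop (𝓝 0) := by
      refine squeeze_zero_norm' ?_ (tendsto_const_mul_one_div_succ (2 * C + L))
      filter_upwards [hx] with n hn
      obtain ⟨A, hA, hdisj, hPA, hFA⟩ := hTA n x hn
      have h1 := abs_integral_comp_sub_le_of_near_points ((T n).measurable_flow x)
        (show (0 : ℝ) ≤ 1 / ((n : ℝ) + 1) by positivity) (hW1 n x) hA hdisj hPA
        (fun k hk ε hε => (dist_pi_le_iff (by positivity)).2 fun i => hFA k hk ε hε i)
        (by positivity) hL hC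
      rw [law_eq_map_flow, integral_map ((T n).measurable_flow x).aemeasurable
        hL.continuous.aestronglyMeasurable]
      refine h1.trans (le_of_eq ?_)
      push_cast
      field_simp
    have h := hclose.add hlim
    simp only [sub_add_cancel, zero_add] at h
    exact h
  exact ⟨T, hT, hKae.mono hmain, fun hcont x => hmain x (hKall hcont x)⟩

end Universality

end

theorem proposition2 (D N : ℕ) (g : Fin N → Density ℝ) :
    -- prior and approximate posterior of every `N`-layer VAE are autoregressive flows
    (∀ V : NLayerVAE D N,
      V.prior.IsFlow g Fin.elim0 ∧ ∀ x : Fin D → ℝ, V.posterior.IsFlow g x) ∧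
    -- neural `N`-layer VAEs are universal approximators
    (∀ σ : ℝ → ℝ, IsSigmoid σ →
      ∀ (G : Fin D → Kernel (Fin N → ℝ) ℝ), (∀ k, IsMarkovKernel (G k)) →
      ∀ (p : Density (Fin N → ℝ)) (q : (Fin D → ℝ) → Density (Fin N → ℝ)),
      Measurable (fun v : (Fin D → ℝ) × (Fin N → ℝ) => (q v.1).pdf v.2) →
      ∀ (μ : Measure (Fin D → ℝ)) [IsProbabilityMeasure μ],
      ∃ V : ℕ → NLayerVAE D N,
        (∀ n, (V n).generator = G ∧ (V n).prior.IsNeural σ ∧ (V n).posterior.IsNeural σ) ∧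
        Tendsto (fun n => (V n).prior.law g Fin.elim0) atTop (𝓝 p.law) ∧
        (∀ᵐ x ∂μ, Tendsto (fun n => (V n).posterior.law g x) atTop (𝓝 (q x).law)) ∧
        (Continuous (fun x => (q x).law) →
          ∀ x, Tendsto (fun n => (V n).posterior.law g x) atTop (𝓝 (q x).law))) := by
  refine ⟨fun V => ⟨V.prior.isFlow g _, fun x => V.posterior.isFlow g x⟩, ?_⟩
  intro σ hσ G hG p q hq μ _
  obtain ⟨S, hS, -, hSp⟩ := TopDown.exists_isNeural_tendsto g hσ (fun _ : Fin 0 → ℝ => p)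
    (p.measurable_pdf.comp measurable_snd) (Measure.dirac Fin.elim0)
  obtain ⟨T, hT, hTae, hTall⟩ := TopDown.exists_isNeural_tendsto g hσ q hq μ
  exact ⟨fun n => ⟨S n, T n, G, hG⟩, fun n => ⟨rfl, hS n, hT n⟩, hSp continuous_const _, hTae,
    hTall⟩
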